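/- Let $f\in C^1(\mathbb{R})$ and consider the scalar conservation law $\partial_t u+\partial_x f(u)=0$ on $\mathbb{R}\times[0,\infty)$. Let $T,M,V,K$ be real constants and let $F:\mathbb{R}^{2p}\to\mathbb{R}$ be a numerical flux that is consistent ($F(c,\dots,c)=f(c)$ for all $c$), Lipschitz on bounded sets, and monotone on $[-M,M]$: writing $F_{i+1/2}(v)=F(v_{i-p+1},\dots,v_{i+p})$, the quantity $F_{i-1/2}(v)-F_{i+1/2}(v)$ is nondecreasing in every $v_j$ with $j\neq i$, for grid values $v_j\in[-M,M]$. For $\Delta x>0$ let $\mathcal{C}_i=[i\Delta x,(i+1)\Delta x)$. Then there is a constant $C$, depending only on $f,F,T,M,V,K$, such that the following holds. Let $(\Omega,\Sigma,P)$ be a probability space and $u_0:\Omega\times\mathbb{R}\to\mathbb{R}$ a (jointly measurable) random field with $\|u_0(\omega)\|_{L^\infty(\mathbb{R})}\le M$ and $\mathrm{TV}(u_0(\omega))\le V$ for all $\omega\in\Omega$. For $0<\Delta x\le 1$ and $\omega\in\Omega$ let $u_0^{\Delta x}(\omega)$ be a function, constant on each cell $\mathcal{C}_i$ with value $u_{0,i}^{\Delta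 x}(\omega)$, which approximates $u_0(\omega)$ in the sense that $$|u_0^{\Delta x}(\omega)|\le M,\qquad \mathrm{TV}(u_0^{\Delta x}(\omega))\le V,\qquad \|u_0^{\Delta x}(\omega)-u_0(\omega)\|_{L^1(\mathbb{R})}\le K\sqrt{\Delta x}$$ (for instance, with $K=V$, the cell averages of $u_0(\omega)$). Let $u^{\Delta x}(\omega)$ be the solution of the semi-discrete monotone scheme $$\frac{d}{dt}u_i^{\Delta x}(t)+\frac{1}{\Delta x}\bigl(F_{i+1/2}(u^{\Delta x}(t))-F_{i-1/2}(u^{\Delta x}(t))\bigr)=0\quad(t>0),\qquad u_i^{\Delta x}(0)=u_{0,i}^{\Delta x}(\omega),\qquad i\in\mathbb{Z},$$ bounded in $i\in\mathbb{Z}$ locally uniformly in $t\ge0$, extended to $\mathbb{R}\times[0,\infty)$ by $u^{\Delta x}(\omega,x,t)=u_i^{\Delta x}(t)$ for $x\in\mathcal{C}_i$, and depending measurably on $\omega$. Let $u(\omega)\in L^\infty(\mathbb{R}\times[0,\infty))$ be the entropy solution with initial data $u_0(\omega)$, that is, the weak solution satisfying the entropy inequality $\partial_t\eta(u)+\partial_x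 q(u)\le0$ (in the sense of distributions, initial data included) for every convex $\eta$ and $q$ with $q'=\eta' f'$, taken to be jointly measurable in $(\omega,x,t)$. Let $\nu^{\Delta x}_{(x,t)}$ and $\nu_{(x,t)}$ be the laws of $u^{\Delta x}(\cdot,x,t)$ and $u(\cdot,x,t)$ under $P$. Then, with $W_1$ the $1$-Wasserstein distance, $$\int_0^T\int_{\mathbb{R}}W_1\bigl(\nu^{\Delta x}_{(x,t)},\nu_{(x,t)}\bigr)\,dx\,dt\le C\sqrt{\Delta x}\qquad\text{for all }0<\Delta x\le1,$$ and $\nu^{\Delta x}\to\nu$ strongly on $\mathbb{R}\times[0,T]$ as $\Delta x\to0$, i.e. $\|W_r(\nu^{\Delta x},\nu)\|_{L^r(\mathbb{R}\times[0,T])}\to0$ for some $r\in[1,\infty)$. -/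

import Mathlib

open MeasureTheory Filter Topology Set
open scoped ENNReal

noncomputable section

/-! ### Scalar conservation laws `∂ₜ u + ∂ₓ f(u) = 0` on `ℝ × [0, ∞)`

Space-time points are pairs `z = (x, t) : ℝ × ℝ`; only times `t ≥ 0` play a role. -/

/-- The space-time domain `ℝ × [0, ∞)`. -/
def spaceTime : Set (ℝ × ℝ) := univ ×ˢ Ici 0

/-- The space-time strip `ℝ × [0, T]`. -/
def spaceTimeStrip (T : ℝ) : Set (ℝ × ℝ) := univ ×ˢ Icc 0 T

/-- Partial derivative in space of a function of `(x, t)`. -/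
def dx (φ : ℝ × ℝ → ℝ) (z : ℝ × ℝ) : ℝ := fderiv ℝ φ z (1, 0)

/-- Partial derivative in time of a function of `(x, t)`. -/
def dt (φ : ℝ × ℝ → ℝ) (z : ℝ × ℝ) : ℝ := fderiv ℝ φ z (0, 1)

/-- Test functions of class `C¹` with compact support in `ℝ × [0, ∞)`, represented by compactly
supported `C¹` extensions to the plane. They need not vanish at `t = 0`. -/
def IsTestFunction (φ : ℝ × ℝ → ℝ) : Prop := ContDiff ℝ 1 φ ∧ HasCompactSupport φ

/-- Entropy pairs of the scalar law with flux `f`: `η` is convex and `q' = η' f'`, in integrated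
form, so that convex functions with corners (such as `|u - k|`) are included. -/
def IsEntropyPair (f η q : ℝ → ℝ) : Prop :=
  ConvexOn ℝ univ η ∧ ∀ a b : ℝ, q b - q a = ∫ ξ in a..b, deriv η ξ * deriv f ξ

/-- Bounded weak solutions of the Cauchy problem with flux `f` and initial data `u₀`. -/
def IsWeakSolution (f : ℝ → ℝ) (u₀ : ℝ → ℝ) (u : ℝ × ℝ → ℝ) : Prop :=
  MemLp u ⊤ (volume.restrict spaceTime) ∧
  ∀ φ : ℝ × ℝ → ℝ, IsTestFunction φ →
    (∫ z in spaceTime, (dt φ z * u z + dx φ z * f (u z))) + ∫ x, φ (x, 0) * u₀ x = 0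

/-- Entropy solutions of the Cauchy problem with flux `f` and initial data `u₀`. -/
def IsEntropySolution (f : ℝ → ℝ) (u₀ : ℝ → ℝ) (u : ℝ × ℝ → ℝ) : Prop :=
  IsWeakSolution f u₀ u ∧
  ∀ η q : ℝ → ℝ, IsEntropyPair f η q →
    ∀ φ : ℝ × ℝ → ℝ, IsTestFunction φ → (∀ z ∈ spaceTime, 0 ≤ φ z) →
      0 ≤ (∫ z in spaceTime, (dt φ z * η (u z) + dx φ z * q (u z))) +
        ∫ x, φ (x, 0) * η (u₀ x)

/-- Total variation of (the almost-everywhere class of) a function on the line: the least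
pointwise variation of a representative. -/
def totalVariation (w : ℝ → ℝ) : ℝ≥0∞ :=
  ⨅ (v : ℝ → ℝ) (_ : v =ᵐ[volume] w), eVariationOn v univ

/-! ### Monotone semi-discrete finite difference schemes

A numerical flux with stencil width `p` is a function `F` of `2p` values, and the flux through
the interface `i + 1/2` is `F (v_{i-p+1}, …, v_{i+p})`. -/

/-- The interface flux `F_{i+1/2}` of grid values `v`. -/
def interfaceFlux {p : ℕ} (F : (Fin (2 * p) → ℝ) → ℝ) (v : ℤ → ℝ) (i : ℤ) : ℝ :=
  F fun k => v (i - p + 1 + (k : ℕ))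

/-- `F` is a numerical flux, consistent with `f` and locally Lipschitz, whose scheme is monotone
for grid values in `[-M, M]`.

Monotonicity of the semi-discrete scheme: the right-hand side `F_{i-1/2} - F_{i+1/2}` of the
evolution of the `i`-th value is nondecreasing in each of the other values `v_j`, `j ≠ i`. For
locally Lipschitz `F` this says that the explicit step `v_i - λ (F_{i+1/2} - F_{i-1/2})` is
nondecreasing in all its arguments on `[-M, M]` when `λ > 0` is small. For `p = 1` it holds if
`F (a, b)` is nondecreasing in `a` and nonincreasing in `b`. -/
structure IsMonotoneFlux (f : ℝ → ℝ) (M : ℝ) {p : ℕ} (F : (Fin (2 * p) → ℝ) → ℝ) : Prop where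
  consistent : ∀ c : ℝ, F (fun _ => c) = f c
  locallyLipschitz : ∀ R : ℝ, ∃ L, LipschitzOnWith L F (Metric.closedBall 0 R)
  monotone : ∀ (v w : ℤ → ℝ) (i : ℤ), (∀ j, |v j| ≤ M) → (∀ j, |w j| ≤ M) →
    (∀ j, v j ≤ w j) → v i = w i →
    interfaceFlux F v (i - 1) - interfaceFlux F v i ≤
      interfaceFlux F w (i - 1) - interfaceFlux F w i

/-- `U i t` is the solution, with exact integration in time, of the semi-discrete scheme
`d/dt U_i + (F_{i+1/2} - F_{i-1/2}) / h = 0` for `t > 0`, with `U_i(0) = a_i`. Solutions are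
understood in the space of bounded grid functions, i.e. bounded in `i`, locally uniformly in
time. -/
structure IsSchemeSolution {p : ℕ} (F : (Fin (2 * p) → ℝ) → ℝ) (h : ℝ) (a : ℤ → ℝ)
    (U : ℤ → ℝ → ℝ) : Prop where
  initial : ∀ i, U i 0 = a i
  continuousOn : ∀ i, ContinuousOn (U i) (Ici 0)
  evolution : ∀ i, ∀ t : ℝ, 0 < t →
    HasDerivAt (U i)
      (-((interfaceFlux F (fun j => U j t) i - interfaceFlux F (fun j => U j t) (i - 1)) / h)) t
  bounded : ∀ T : ℝ, ∃ B : ℝ, ∀ i, ∀ t ∈ Icc 0 T, |U i t| ≤ B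

/-- The function of space which takes the value `a i` on the cell `[i h, (i + 1) h)`. -/
def cellFunction (h : ℝ) (a : ℤ → ℝ) (x : ℝ) : ℝ := a ⌊x / h⌋

/-- The function of space and time which is `U i t` on the cell `[i h, (i + 1) h)`. -/
def gridFunction (h : ℝ) (U : ℤ → ℝ → ℝ) (z : ℝ × ℝ) : ℝ := cellFunction h (fun i => U i z.2) z.1

/-! ### Young measures, Wasserstein distance, strong convergence -/

/-- The law of a random field `u`: the Young measure `z ↦ P (u(z) ∈ ·)`. -/
def lawOf {Ω : Type*} [MeasurableSpace Ω] (P : Measure Ω) (u : Ω → ℝ × ℝ → ℝ) (z : ℝ × ℝ) :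
    Measure ℝ := P.map fun ω => u ω z

/-- `π` is a probability measure on the plane with marginals `μ` and `ρ`. -/
def IsCoupling (π : Measure (ℝ × ℝ)) (μ ρ : Measure ℝ) : Prop :=
  IsProbabilityMeasure π ∧ π.map Prod.fst = μ ∧ π.map Prod.snd = ρ

/-- The `p`-Wasserstein distance, with values in `[0, ∞]`. -/
def wasserstein (p : ℝ) (μ ρ : Measure ℝ) : ℝ≥0∞ :=
  (⨅ (π : Measure (ℝ × ℝ)) (_ : IsCoupling π μ ρ),
    ∫⁻ y, ENNReal.ofReal |y.1 - y.2| ^ p ∂π) ^ (1 / p)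

/-- Strong convergence on `D` of Young measures `ν i` to `ν'` along the filter `l`:
`‖W_p (ν i, ν')‖` tends to zero in `L^p(D)`, for some `p ∈ [1, ∞)`. -/
def ConvergesStrongly {ι : Type*} (D : Set (ℝ × ℝ)) (l : Filter ι)
    (ν : ι → ℝ × ℝ → Measure ℝ) (ν' : ℝ × ℝ → Measure ℝ) : Prop :=
  ∃ p : ℝ, 1 ≤ p ∧
    Tendsto (fun i => (∫⁻ z in D, wasserstein p (ν i z) (ν' z) ^ p) ^ (1 / p)) l (𝓝 0)

end

/-! The estimate is proved for each sample and then averaged. The joint law of the two fields at a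
point is a coupling of their laws, so `W₁` is at most the mean of `|u^Δx - u|`
(`wasserstein_one_lawOf_le`). By Tonelli it suffices to have a deterministic `L¹` error bound whose
constant does not depend on the datum (`IsSchemeSolution.lintegral_abs_sub_le`). Strong convergence
is then the case `r = 1`.

The deterministic bound is a Kuznetsov argument in which only the space variable is doubled.
Monotonicity makes `[-M, M]` invariant and gives `ℓ¹` contraction, hence a variation bound, together
with the cell entropy inequality `d/dt |c - U_i| ≤ (Q_{i-1/2} - Q_{i+1/2}) / h`. Since `U_i` is
Lipschitz in time, it can play the role of a time-dependent constant in Kruzhkov's inequality for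
`u` (`IsEntropySolution.kruzkov_time_dependent`).

That inequality is tested with `χ w_i`, where `w_i` is the indicator of cell `i` mollified at scale
`ε` and `χ` is a cutoff on a backward cone, and is summed over `i`. After summation by parts, exact
and numerical entropy fluxes differ by the stencil variation times weight errors of size `h / ε²`,
living on intervals of length `2ε + h` (`sum_flux_consistency_le`). The mollification itself costs
`2ε + h` times the variation. The choice `ε = √h` makes everything `O(√h)`.

The cutoff satisfies `∂ₜχ + ℓ|∂ₓχ| ≤ -χ`, so the sum produces `-∫ χ |u - U|`: the space-time error
is bounded directly, without a Gronwall step, and undoing the decay of `χ` costs the factor `e^T`.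
The speed `ℓ` depends on the bound of `u` but does not enter the constant. Values of `u` outside
`[-M, M]`, where the scheme need not be monotone, are handled by projecting onto that interval
(`clip`). -/

noncomputable section

/-! ### A piecewise linear bump function and its primitive -/

/-- The piecewise linear B-spline supported in `[0, 2]`. -/
def hat (x : ℝ) : ℝ := max x 0 - 2 * max (x - 1) 0 + max (x - 2) 0

/-- The primitive of `hat`: a `C¹` step from `0` to `1` across `[0, 2]`. -/
def smoothStep (x : ℝ) : ℝ :=
  max x 0 ^ 2 / 2 - 2 * (max (x - 1) 0 ^ 2 / 2) + max (x - 2) 0 ^ 2 / 2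

lemma hasDerivAt_max_zero_sq (x : ℝ) :
    HasDerivAt (fun y : ℝ => max y 0 ^ 2 / 2) (max x 0) x := by
  rcases lt_trichotomy x 0 with h | rfl | h
  · rw [max_eq_right h.le]
    refine (hasDerivAt_const x (0 : ℝ)).congr_of_eventuallyEq ?_
    filter_upwards [Iio_mem_nhds h] with y hy
    simp [max_eq_right (le_of_lt (mem_Iio.1 hy))]
  · rw [max_self, hasDerivAt_iff_isLittleO_nhds_zero]
    have : (fun y : ℝ => max (0 + y) 0 ^ 2 / 2 - max (0 : ℝ) 0 ^ 2 / 2 - y • (0 : ℝ)) =O[𝓝 0]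
        fun y => y ^ 2 := by
      refine Asymptotics.IsBigO.of_bound 1 (Eventually.of_forall fun y => ?_)
      rcases le_total y 0 with h | h <;> simp [h, abs_of_nonneg, sq_nonneg]
    refine this.trans_isLittleO ?_
    simpa using Asymptotics.isLittleO_pow_id (𝕜 := ℝ) (n := 2) (by norm_num)
  · rw [max_eq_left h.le]
    have : HasDerivAt (fun y : ℝ => y ^ 2 / 2) x x := by
      simpa using (hasDerivAt_pow 2 x).div_const 2
    refine this.congr_of_eventuallyEq ?_
    filter_upwards [Ioi_mem_nhds h] with y hy
    simp [max_eq_left (le_of_lt (mem_Ioi.1 hy))]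

lemma hasDerivAt_smoothStep (x : ℝ) : HasDerivAt smoothStep (hat x) x := by
  have h (c : ℝ) : HasDerivAt (fun y : ℝ => max (y - c) 0 ^ 2 / 2) (max (x - c) 0) x :=
    (hasDerivAt_max_zero_sq (x - c)).comp_sub_const x c
  exact ((hasDerivAt_max_zero_sq x).sub ((h 1).const_mul 2)).add (h 2)

@[fun_prop]
lemma continuous_hat : Continuous hat := by unfold hat; fun_prop

@[fun_prop]
lemma contDiff_smoothStep : ContDiff ℝ 1 smoothStep := by
  refine contDiff_one_iff_deriv.2 ⟨fun x => (hasDerivAt_smoothStep x).differentiableAt, ?_⟩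
  rw [funext fun x => (hasDerivAt_smoothStep x).deriv]
  exact continuous_hat

@[fun_prop]
lemma continuous_smoothStep : Continuous smoothStep := contDiff_smoothStep.continuous

lemma hat_nonneg (x : ℝ) : 0 ≤ hat x := by unfold hat; grind

lemma hat_of_nonpos {x : ℝ} (h : x ≤ 0) : hat x = 0 := by unfold hat; grind

lemma hat_of_two_le {x : ℝ} (h : 2 ≤ x) : hat x = 0 := by unfold hat; grind

lemma abs_hat_sub_le (x y : ℝ) : |hat x - hat y| ≤ |x - y| := by unfold hat; grind

lemma smoothStep_of_nonpos {x : ℝ} (h : x ≤ 0) : smoothStep x = 0 := by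
  simp [smoothStep, max_eq_right h, max_eq_right (show x - 1 ≤ 0 by linarith),
    max_eq_right (show x - 2 ≤ 0 by linarith)]

lemma smoothStep_of_two_le {x : ℝ} (h : 2 ≤ x) : smoothStep x = 1 := by
  simp only [smoothStep, max_eq_left (show 0 ≤ x by linarith),
    max_eq_left (show 0 ≤ x - 1 by linarith), max_eq_left (show 0 ≤ x - 2 by linarith)]
  ring

lemma smoothStep_monotone : Monotone smoothStep :=
  monotone_of_deriv_nonneg (fun x => (hasDerivAt_smoothStep x).differentiableAt)
    fun x => by rw [(hasDerivAt_smoothStep x).deriv]; exact hat_nonneg x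

lemma smoothStep_nonneg (x : ℝ) : 0 ≤ smoothStep x := by
  rw [← smoothStep_of_nonpos (min_le_right x 0)]
  exact smoothStep_monotone (min_le_left _ _)

lemma smoothStep_le_one (x : ℝ) : smoothStep x ≤ 1 := by
  rw [← smoothStep_of_two_le (le_max_right x 2)]
  exact smoothStep_monotone (le_max_left _ _)

/-- The integer translates of `hat` form a partition of unity. -/
lemma sum_range_hat (x : ℝ) (n : ℕ) (h₀ : x ≤ 1) (h₁ : 2 ≤ x + n) :
    ∑ i ∈ Finset.range n, hat (x + i) = 1 := by
  have key (m : ℕ) : ∑ i ∈ Finset.range m, hat (x + i) =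
      (max (x + m - 1) 0 - max (x + m - 2) 0) - (max (x - 1) 0 - max (x - 2) 0) := by
    induction m with
    | zero => simp
    | succ m ih => rw [Finset.sum_range_succ, ih]; unfold hat; push_cast; ring_nf
  rw [key]
  grind

/-! ### One-sided differential inequalities for the absolute value -/

/-- The right Dini derivative of `|z|` is `z'` or `-z'` where `z ≠ 0`. At a zero of `z` it is
`|z'|`, and there both sign hypotheses apply. -/
lemma abs_le_add_integral {z z' g : ℝ → ℝ} {a b : ℝ} (hab : a ≤ b)
    (hz : ContinuousOn z (Icc a b)) (hg : ContinuousOn g (Icc a b))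
    (hz' : ∀ t ∈ Ico a b, HasDerivWithinAt z (z' t) (Ici t) t)
    (hpos : ∀ t ∈ Ico a b, 0 ≤ z t → z' t ≤ g t)
    (hneg : ∀ t ∈ Ico a b, z t ≤ 0 → -z' t ≤ g t) :
    |z b| ≤ |z a| + ∫ t in a..b, g t := by
  have hint : IntervalIntegrable g volume a b :=
    (hg.mono (by rw [uIcc_of_le hab])).intervalIntegrable
  have main := image_le_of_liminf_slope_right_le_deriv_boundary (f := fun t => |z t|)
    (B := fun t => |z a| + ∫ s in a..t, g s) (B' := g) (a := a) (b := b)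
    hz.abs (by simp) ?_ ?_ ?_ (right_mem_Icc.2 hab)
  · exact main
  · refine continuousOn_const.add ?_
    have := intervalIntegral.continuousOn_primitive_interval
      ((hg.mono (by rw [uIcc_of_le hab])).integrableOn_compact isCompact_uIcc (μ := volume))
    rwa [uIcc_of_le hab] at this
  · intro t ht
    refine HasDerivWithinAt.const_add _ ?_
    refine intervalIntegral.integral_hasDerivWithinAt_right (s := Ici t) (t := Ioi t)
      (hint.mono_set ?_) ?_ ?_
    · rw [uIcc_of_le hab, uIcc_of_le ht.1]; exact Icc_subset_Icc_right ht.2.le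
    · refine ⟨Ioc t b, Ioc_mem_nhdsGT ht.2, ?_⟩
      exact (hg.mono fun x hx => ⟨ht.1.trans hx.1.le, hx.2⟩).aestronglyMeasurable measurableSet_Ioc
    · have := (hg t ⟨ht.1, ht.2.le⟩).mono_of_mem_nhdsWithin
        (mem_of_superset (Ioc_mem_nhdsGT ht.2) fun x hx => ⟨ht.1.trans (le_of_lt hx.1), hx.2⟩)
      exact this
  · intro t ht r hr
    refine Eventually.frequently ?_
    have hd := (hasDerivWithinAt_iff_tendsto_slope' (by simp)).1 ((hz' t ht).mono Ioi_subset_Ici_self)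
    have hc : Tendsto z (𝓝[>] t) (𝓝 (z t)) := (hz' t ht).continuousWithinAt.mono Ioi_subset_Ici_self
    rcases lt_trichotomy (z t) 0 with h | h | h
    · filter_upwards [hd.neg.eventually_lt_const ((hneg t ht h.le).trans_lt hr),
        hc.eventually_lt_const h] with x hx hx0
      rw [slope_def_field, abs_of_neg h, abs_of_neg hx0]
      rw [slope_def_field] at hx
      rwa [neg_sub_neg, ← neg_sub, neg_div]
    · have h2 : |z' t| < r := (abs_le'.2 ⟨hpos t ht h.ge, hneg t ht h.le⟩).trans_lt hr
      filter_upwards [hd.abs.eventually_lt_const h2, self_mem_nhdsWithin] with x hx hxt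
      have hxt' : t < x := hxt
      rw [slope_def_field, abs_div, abs_of_pos (sub_pos.2 hxt'), h] at hx
      rw [slope_def_field]
      simpa [h] using hx
    · filter_upwards [hd.eventually_lt_const ((hpos t ht h.le).trans_lt hr),
        hc.eventually_const_lt h] with x hx hx0
      rw [slope_def_field] at hx ⊢
      rwa [abs_of_pos h, abs_of_pos hx0]

/-! ### Interface fluxes -/

/-- The interface fluxes of grid values in `[-R, R]` are Lipschitz with constant `L` in the sup
norm over the stencil. -/
def IsFluxLipschitz {p : ℕ} (F : (Fin (2 * p) → ℝ) → ℝ) (R L : ℝ) : Prop :=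
  0 ≤ L ∧ ∀ (v w : ℤ → ℝ) (i : ℤ) (s : ℝ), (∀ j, |v j| ≤ R) → (∀ j, |w j| ≤ R) → 0 ≤ s →
    (∀ j, i - p + 1 ≤ j → j ≤ i + p → |v j - w j| ≤ s) →
    |interfaceFlux F v i - interfaceFlux F w i| ≤ L * s

/-- The right-hand side of the semi-discrete scheme. -/
def schemeRHS {p : ℕ} (F : (Fin (2 * p) → ℝ) → ℝ) (h : ℝ) (v : ℤ → ℝ) (i : ℤ) : ℝ :=
  -((interfaceFlux F v i - interfaceFlux F v (i - 1)) / h)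

/-- The numerical entropy flux of the pair `v`, `w`, consistent with
`sign (v - w) * (f v - f w)`. -/
def fluxGap {p : ℕ} (F : (Fin (2 * p) → ℝ) → ℝ) (v w : ℤ → ℝ) (i : ℤ) : ℝ :=
  interfaceFlux F (fun j => max (v j) (w j)) i - interfaceFlux F (fun j => min (v j) (w j)) i

section Flux

variable {f : ℝ → ℝ} {M : ℝ} {p : ℕ} {F : (Fin (2 * p) → ℝ) → ℝ}

lemma IsMonotoneFlux.continuous (hF : IsMonotoneFlux f M F) : Continuous F := by
  refine continuous_iff_continuousAt.2 fun x => ?_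
  obtain ⟨L, hL⟩ := hF.locallyLipschitz (‖x‖ + 1)
  refine hL.continuousOn.continuousAt ?_
  refine mem_of_superset (Metric.ball_mem_nhds x one_pos) fun y hy => ?_
  rw [mem_closedBall_zero_iff]
  have := norm_le_norm_add_norm_sub x y
  rw [norm_sub_rev, ← dist_eq_norm] at this
  exact this.trans (by gcongr; exact (Metric.mem_ball.1 hy).le)

lemma IsMonotoneFlux.exists_isFluxLipschitz (hF : IsMonotoneFlux f M F) {R : ℝ} (hR : 0 ≤ R) :
    ∃ L, IsFluxLipschitz F R L := by
  obtain ⟨L, hL⟩ := hF.locallyLipschitz R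
  refine ⟨L, L.2, fun v w i s hv hw hs hvw => ?_⟩
  have hmem (v : ℤ → ℝ) (hv : ∀ j, |v j| ≤ R) :
      (fun k : Fin (2 * p) => v (i - p + 1 + (k : ℕ))) ∈ Metric.closedBall 0 R := by
    rw [mem_closedBall_zero_iff]
    exact (pi_norm_le_iff_of_nonneg hR).2 fun k => hv _
  refine (Real.dist_eq _ _ ▸ hL.dist_le_mul _ (hmem v hv) _ (hmem w hw)).trans ?_
  gcongr
  refine (dist_pi_le_iff hs).2 fun k => ?_
  rw [Real.dist_eq]
  have := k.2
  exact hvw _ (by lia) (by lia)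

lemma interfaceFlux_const (hF : IsMonotoneFlux f M F) (c : ℝ) (i : ℤ) :
    interfaceFlux F (fun _ => c) i = f c := hF.consistent c

lemma schemeRHS_const (hF : IsMonotoneFlux f M F) (h c : ℝ) (i : ℤ) :
    schemeRHS F h (fun _ => c) i = 0 := by
  simp [schemeRHS, interfaceFlux_const hF]

lemma IsMonotoneFlux.schemeRHS_le (hF : IsMonotoneFlux f M F) {h : ℝ} (hh : 0 < h) {v w : ℤ → ℝ}
    {i : ℤ} (hv : ∀ j, |v j| ≤ M) (hw : ∀ j, |w j| ≤ M) (hvw : ∀ j, v j ≤ w j)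
    (hi : v i = w i) : schemeRHS F h v i ≤ schemeRHS F h w i := by
  have := hF.monotone v w i hv hw hvw hi
  rw [schemeRHS, schemeRHS, neg_le_neg_iff]
  gcongr ?_ / h
  linarith

lemma IsFluxLipschitz.abs_schemeRHS_sub_le {R L : ℝ} (hL : IsFluxLipschitz F R L) {h : ℝ}
    (hh : 0 < h) {v w : ℤ → ℝ} {i : ℤ} {s : ℝ} (hv : ∀ j, |v j| ≤ R) (hw : ∀ j, |w j| ≤ R)
    (hs : 0 ≤ s) (hvw : ∀ j, |v j - w j| ≤ s) :
    |schemeRHS F h v i - schemeRHS F h w i| ≤ 2 * L * s / h := by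
  have h1 := hL.2 v w i s hv hw hs fun j _ _ => hvw j
  have h2 := hL.2 v w (i - 1) s hv hw hs fun j _ _ => hvw j
  have : schemeRHS F h v i - schemeRHS F h w i =
      ((interfaceFlux F v (i - 1) - interfaceFlux F w (i - 1)) -
        (interfaceFlux F v i - interfaceFlux F w i)) / h := by
    unfold schemeRHS; ring
  rw [this, abs_div, abs_of_pos hh]
  gcongr
  refine (abs_sub _ _).trans ?_
  linarith

lemma abs_max_le_of {R x y : ℝ} (hx : |x| ≤ R) (hy : |y| ≤ R) : |max x y| ≤ R := by
  rcases max_choice x y with h | h <;> rwa [h]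

lemma abs_min_le_of {R x y : ℝ} (hx : |x| ≤ R) (hy : |y| ≤ R) : |min x y| ≤ R := by
  rcases min_choice x y with h | h <;> rwa [h]

lemma IsFluxLipschitz.abs_fluxGap_le {R L : ℝ} (hL : IsFluxLipschitz F R L) {v w : ℤ → ℝ} {i : ℤ}
    {s : ℝ} (hv : ∀ j, |v j| ≤ R) (hw : ∀ j, |w j| ≤ R) (hs : 0 ≤ s)
    (hvw : ∀ j, i - p + 1 ≤ j → j ≤ i + p → |v j - w j| ≤ s) :
    |fluxGap F v w i| ≤ L * s := by
  refine hL.2 _ _ i s (fun j => abs_max_le_of (hv j) (hw j))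
    (fun j => abs_min_le_of (hv j) (hw j)) hs fun j h1 h2 => ?_
  rw [max_sub_min_eq_abs', abs_abs]
  exact hvw j h1 h2

/-- The entropy inequality of the scheme, in the differential form for a pair of grid functions. -/
lemma IsMonotoneFlux.schemeRHS_sub_le (hF : IsMonotoneFlux f M F) {h : ℝ} (hh : 0 < h)
    {v w : ℤ → ℝ} {i : ℤ} (hv : ∀ j, |v j| ≤ M) (hw : ∀ j, |w j| ≤ M) (hi : w i ≤ v i) :
    schemeRHS F h v i - schemeRHS F h w i ≤ (fluxGap F v w (i - 1) - fluxGap F v w i) / h := by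
  -- At cell `i` the maximum of the two grid functions agrees with `v` and the minimum with `w`, so
  -- monotonicity applies to both comparisons.
  have h1 := hF.schemeRHS_le hh hv (fun j => abs_max_le_of (hv j) (hw j))
    (fun j => le_max_left _ _) (max_eq_left hi).symm
  have h2 := hF.schemeRHS_le hh (fun j => abs_min_le_of (hv j) (hw j)) hw
    (fun j => min_le_right _ _) (min_eq_right hi)
  refine (sub_le_sub h1 h2).trans_eq ?_
  unfold schemeRHS fluxGap
  ring

lemma fluxGap_comm (v w : ℤ → ℝ) (i : ℤ) : fluxGap F v w i = fluxGap F w v i := by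
  simp [fluxGap, max_comm, min_comm]

/-! ### Solutions of the scheme -/

variable {h : ℝ} {a : ℤ → ℝ} {U : ℤ → ℝ → ℝ}

lemma continuousOn_interfaceFlux (hF : IsMonotoneFlux f M F) {s : Set ℝ}
    (hU : ∀ i, ContinuousOn (U i) s) (i : ℤ) :
    ContinuousOn (fun t => interfaceFlux F (fun j => U j t) i) s :=
  hF.continuous.comp_continuousOn (continuousOn_pi.2 fun _ => hU _)

lemma continuousOn_fluxGap (hF : IsMonotoneFlux f M F) {W : ℤ → ℝ → ℝ} {s : Set ℝ}
    (hU : ∀ i, ContinuousOn (U i) s) (hW : ∀ i, ContinuousOn (W i) s) (i : ℤ) :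
    ContinuousOn (fun t => fluxGap F (fun j => U j t) (fun j => W j t) i) s :=
  (continuousOn_interfaceFlux hF (U := fun j t => max (U j t) (W j t))
    (fun j => (hU j).sup (hW j)) i).sub
  (continuousOn_interfaceFlux hF (U := fun j t => min (U j t) (W j t))
    (fun j => (hU j).inf (hW j)) i)

/-- At `t = 0` the equation is not part of the definition; the right derivative there is the limit
of the derivatives, by continuity of the right-hand side. -/
lemma IsSchemeSolution.hasDerivWithinAt (hU : IsSchemeSolution F h a U)
    (hF : IsMonotoneFlux f M F) (i : ℤ) {t : ℝ} (ht : 0 ≤ t) :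
    HasDerivWithinAt (U i) (schemeRHS F h (fun j => U j t) i) (Ici t) t := by
  rcases ht.eq_or_lt with rfl | ht
  · refine hasDerivWithinAt_Ici_of_tendsto_deriv (s := Ioi 0)
      (fun x hx => (hU.evolution i x hx).differentiableAt.differentiableWithinAt)
      ((hU.continuousOn i 0 self_mem_Ici).mono Ioi_subset_Ici_self) self_mem_nhdsWithin ?_
    have : ContinuousOn (fun t => schemeRHS F h (fun j => U j t) i) (Ici 0) :=
      (((continuousOn_interfaceFlux hF hU.continuousOn i).sub
        (continuousOn_interfaceFlux hF hU.continuousOn (i - 1))).div_const h).neg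
    refine ((this 0 self_mem_Ici).mono Ioi_subset_Ici_self).tendsto.congr' ?_
    filter_upwards [self_mem_nhdsWithin] with x hx
    exact (hU.evolution i x hx).deriv.symm
  · exact (hU.evolution i t ht).hasDerivWithinAt

/-- By consistency constants solve the scheme, so comparing two solutions includes comparison with
Kruzhkov's constants. -/
lemma isSchemeSolution_const (hF : IsMonotoneFlux f M F) (h c : ℝ) :
    IsSchemeSolution F h (fun _ => c) (fun _ _ => c) where
  initial _ := rfl
  continuousOn _ := continuousOn_const
  evolution i t _ := by
    simpa [interfaceFlux_const hF] using hasDerivAt_const t c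
  bounded _ := ⟨|c|, fun _ _ _ => le_rfl⟩

lemma IsSchemeSolution.shift (hU : IsSchemeSolution F h a U) :
    IsSchemeSolution F h (fun i => a (i + 1)) (fun i => U (i + 1)) where
  initial i := hU.initial _
  continuousOn i := hU.continuousOn _
  evolution i t ht := by
    have hs (i : ℤ) : interfaceFlux F (fun j => U (j + 1) t) i =
        interfaceFlux F (fun j => U j t) (i + 1) :=
      congrArg F (funext fun k => congrArg (fun j => U j t) (by ring))
    have := hU.evolution (i + 1) t ht
    rwa [hs, hs, show i - 1 + 1 = i + 1 - 1 by ring]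
  bounded T := (hU.bounded T).imp fun B hB i => hB _

/-- Where a grid function of size at most `M + s` reaches above `M`, the scheme increases it at
most at the rate `2 * L * s / h`. -/
lemma schemeRHS_le_of_le (hF : IsMonotoneFlux f M F) (hM : 0 ≤ M) {R L : ℝ} (hMR : M ≤ R)
    (hL : IsFluxLipschitz F R L) (hh : 0 < h) {v : ℤ → ℝ} {s : ℝ} (hs : 0 ≤ s)
    (hv : ∀ j, |v j| ≤ R) (hvs : ∀ j, |v j| ≤ M + s) {i : ℤ} (hi : M ≤ v i) :
    schemeRHS F h v i ≤ 2 * L * s / h := by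
  -- Truncation to `[-M, M]` moves each value by at most `s` and gives exactly `M` at `i`. There the
  -- truncated rate is at most that of the constant `M`, which is zero.
  set w : ℤ → ℝ := fun j => max (-M) (min M (v j)) with hw
  have hwM (j) : |w j| ≤ M := by simp only [hw]; grind
  have hvw (j) : |v j - w j| ≤ s := by have := hvs j; simp only [hw]; grind
  have h1 := hL.abs_schemeRHS_sub_le (i := i) hh hv (fun j => (hwM j).trans hMR) hs hvw
  have h2 := hF.schemeRHS_le (v := w) (w := fun _ => M) (i := i) hh hwM
    (fun j => (abs_of_nonneg hM).le) (fun j => (le_abs_self _).trans (hwM j))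
    (by simp only [hw]; grind)
  rw [schemeRHS_const hF] at h2
  linarith [le_abs_self (schemeRHS F h v i - schemeRHS F h w i)]

lemma neg_schemeRHS_le_of_le (hF : IsMonotoneFlux f M F) (hM : 0 ≤ M) {R L : ℝ} (hMR : M ≤ R)
    (hL : IsFluxLipschitz F R L) (hh : 0 < h) {v : ℤ → ℝ} {s : ℝ} (hs : 0 ≤ s)
    (hv : ∀ j, |v j| ≤ R) (hvs : ∀ j, |v j| ≤ M + s) {i : ℤ} (hi : v i ≤ -M) :
    -schemeRHS F h v i ≤ 2 * L * s / h := by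
  set w : ℤ → ℝ := fun j => max (-M) (min M (v j)) with hw
  have hwM (j) : |w j| ≤ M := by simp only [hw]; grind
  have hvw (j) : |v j - w j| ≤ s := by have := hvs j; simp only [hw]; grind
  have h1 := hL.abs_schemeRHS_sub_le (i := i) hh hv (fun j => (hwM j).trans hMR) hs hvw
  have h2 := hF.schemeRHS_le (v := fun _ => -M) (w := w) (i := i) hh
    (fun j => by rw [abs_neg, abs_of_nonneg hM]) hwM (fun j => (abs_le.1 (hwM j)).1)
    (by simp only [hw]; grind)
  rw [schemeRHS_const hF] at h2
  linarith [neg_abs_le (schemeRHS F h v i - schemeRHS F h w i)]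

/-- The interval `[-M, M]`, on which the scheme is monotone, is invariant. -/
lemma IsSchemeSolution.abs_le (hU : IsSchemeSolution F h a U) (hF : IsMonotoneFlux f M F)
    (hh : 0 < h) (hM : 0 ≤ M) (ha : ∀ i, |a i| ≤ M) (i : ℤ) {t : ℝ} (ht : 0 ≤ t) :
    |U i t| ≤ M := by
  obtain ⟨B, hB⟩ := hU.bounded t
  set R := max B M
  have hR (i) (s) (hs : s ∈ Icc 0 t) : |U i s| ≤ R := (hB i s hs).trans (le_max_left _ _)
  have hMR : M ≤ R := le_max_right _ _
  obtain ⟨L, hL⟩ := hF.exists_isFluxLipschitz (hM.trans hMR)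
  have hL0 := hL.1
  -- Chosen so that a barrier of half the height still grows strictly faster than the rate `2 L σ
  -- e^{ct} / h` allowed by the full height.
  set c := 4 * L / h + 1 with hc
  have hc0 : 0 < c := by positivity
  -- With infinitely many cells the maximum need not be attained. Instead a bound on the excess over
  -- `M`, valid for all cells, is halved at each induction step by a barrier argument in each single
  -- cell.
  have claim (n : ℕ) : ∀ i, ∀ s ∈ Icc 0 t,
      |U i s| ≤ M + (R + 1) / 2 ^ n * Real.exp (c * s) := by
    induction n with
    | zero =>
      intro i s hs
      have h1 : 1 ≤ Real.exp (c * s) := Real.one_le_exp (mul_nonneg hc0.le hs.1)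
      have h2 := hR i s hs
      have h3 : 0 ≤ R := hM.trans hMR
      simp only [pow_zero, div_one]
      nlinarith
    | succ n ih =>
      intro i s hs
      set σ := (R + 1) / 2 ^ n with hσ
      have hσ0 : 0 < σ := by have : 0 ≤ R := hM.trans hMR; positivity
      have hσ' : (R + 1) / 2 ^ (n + 1) = σ / 2 := by rw [hσ, pow_succ]; field_simp
      rw [hσ']
      have hbd (x : ℝ) : HasDerivAt (fun y => M + σ / 2 * Real.exp (c * y))
          (σ / 2 * (c * Real.exp (c * x))) x := by
        have := (((hasDerivAt_id x).const_mul c).exp.const_mul (σ / 2)).const_add M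
        simpa [mul_comm] using this
      have hrate (x : ℝ) :
          2 * L * (σ * Real.exp (c * x)) / h < σ / 2 * (c * Real.exp (c * x)) := by
        have : σ / 2 * (c * Real.exp (c * x)) - 2 * L * (σ * Real.exp (c * x)) / h =
          σ / 2 * Real.exp (c * x) := by rw [hc]; field_simp; ring
        have : 0 < σ / 2 * Real.exp (c * x) := by positivity
        linarith
      have hcont : ContinuousOn (U i) (Icc 0 t) := (hU.continuousOn i).mono Icc_subset_Ici_self
      have hpos (x : ℝ) : 0 < σ * Real.exp (c * x) := by positivity
      refine abs_le'.2 ⟨?_, ?_⟩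
      · refine image_le_of_deriv_right_lt_deriv_boundary hcont
          (fun x hx => hU.hasDerivWithinAt hF i hx.1) ?_ hbd ?_ hs
        · rw [hU.initial]
          have := (le_abs_self _).trans (ha i)
          have := hpos 0
          linarith
        · intro x hx hxe
          refine (schemeRHS_le_of_le hF hM hMR hL hh (hpos x).le
            (fun j => hR j x ⟨hx.1, hx.2.le⟩) (fun j => ih j x ⟨hx.1, hx.2.le⟩) ?_).trans_lt
            (hrate x)
          rw [hxe]; linarith [hpos x]
      · refine image_le_of_deriv_right_lt_deriv_boundary hcont.neg
          (fun x hx => (hU.hasDerivWithinAt hF i hx.1).neg) ?_ hbd ?_ hs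
        · have := (neg_le_abs _).trans (ha i)
          have := hpos 0
          simp only [Pi.neg_apply, hU.initial]
          linarith
        · intro x hx hxe
          refine (neg_schemeRHS_le_of_le hF hM hMR hL hh (hpos x).le
            (fun j => hR j x ⟨hx.1, hx.2.le⟩) (fun j => ih j x ⟨hx.1, hx.2.le⟩) ?_).trans_lt
            (hrate x)
          have := hpos x
          simp only [Pi.neg_apply] at hxe
          linarith
  have hlim : Tendsto (fun n : ℕ => M + (R + 1) / 2 ^ n * Real.exp (c * t)) atTop
      (𝓝 (M + 0 * Real.exp (c * t))) := by
    refine tendsto_const_nhds.add (Tendsto.mul_const _ ?_)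
    exact tendsto_const_nhds.div_atTop (tendsto_pow_atTop_atTop_of_one_lt one_lt_two)
  refine (ge_of_tendsto' hlim fun n => claim n i t (right_mem_Icc.2 ht)).trans_eq ?_
  ring

/-- The integrated entropy inequality of the scheme for a pair of solutions. -/
lemma IsSchemeSolution.abs_sub_le_add_integral {b : ℤ → ℝ} {W : ℤ → ℝ → ℝ}
    (hU : IsSchemeSolution F h a U) (hW : IsSchemeSolution F h b W) (hF : IsMonotoneFlux f M F)
    (hh : 0 < h) (hUM : ∀ i, ∀ t, 0 ≤ t → |U i t| ≤ M) (hWM : ∀ i, ∀ t, 0 ≤ t → |W i t| ≤ M)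
    (i : ℤ) {s t : ℝ} (hs : 0 ≤ s) (hst : s ≤ t) :
    |U i t - W i t| ≤ |U i s - W i s| +
      ∫ r in s..t, (fluxGap F (fun j => U j r) (fun j => W j r) (i - 1) -
        fluxGap F (fun j => U j r) (fun j => W j r) i) / h := by
  have hsub : Icc s t ⊆ Ici 0 := fun x hx => hs.trans hx.1
  refine abs_le_add_integral (z := fun r => U i r - W i r)
    (z' := fun r => schemeRHS F h (fun j => U j r) i - schemeRHS F h (fun j => W j r) i) hst
    (((hU.continuousOn i).sub (hW.continuousOn i)).mono hsub) ?_ ?_ ?_ ?_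
  · exact (((continuousOn_fluxGap hF hU.continuousOn hW.continuousOn (i - 1)).sub
      (continuousOn_fluxGap hF hU.continuousOn hW.continuousOn i)).div_const h).mono hsub
  · intro r hr
    have := hs.trans hr.1
    exact (hU.hasDerivWithinAt hF i this).sub (hW.hasDerivWithinAt hF i this)
  · intro r hr h0
    have := hs.trans hr.1
    exact hF.schemeRHS_sub_le hh (fun j => hUM j r this) (fun j => hWM j r this) (by linarith)
  · intro r hr h0
    have := hs.trans hr.1
    rw [neg_sub, fluxGap_comm, fluxGap_comm (F := F) (fun j => U j r)]
    exact hF.schemeRHS_sub_le hh (fun j => hWM j r this) (fun j => hUM j r this) (by linarith)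

/-! ### `ℓ¹` contraction, variation bound and time regularity of the scheme -/

lemma sum_Ico_int (g : ℤ → ℝ) (a : ℤ) (m : ℕ) :
    ∑ i ∈ Finset.Ico a (a + m), g i = ∑ k ∈ Finset.range m, g (a + k) := by
  induction m with
  | zero => simp
  | succ m ih =>
    rw [Finset.sum_range_succ, ← ih, Nat.cast_succ, ← add_assoc,
      ← Finset.insert_Ico_right_eq_Ico_add_one (by lia), Finset.sum_insert (by simp), add_comm]

lemma sum_Ico_int_sub (g : ℤ → ℝ) {a b : ℤ} (hab : a ≤ b) :
    ∑ i ∈ Finset.Ico a b, (g (i + 1) - g i) = g b - g a := by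
  obtain ⟨m, rfl⟩ := Int.le.dest hab
  have := Finset.sum_range_sub (fun k : ℕ => g (a + k)) m
  simp only [Nat.cast_zero, add_zero, Nat.cast_add, Nat.cast_one] at this
  rw [sum_Ico_int, ← this]
  simp [add_assoc]

lemma exists_subset_Ico_int (s : Finset ℤ) : ∃ n : ℕ, ∀ j ∈ s, -(n : ℤ) ≤ j ∧ j < n := by
  refine ⟨∑ j ∈ s, (j.natAbs + 1), fun j hj => ?_⟩
  have := Finset.single_le_sum (f := fun j : ℤ => j.natAbs + 1) (fun _ _ => Nat.zero_le _) hj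
  lia

/-- Solutions of the scheme depend contractively in `ℓ¹` on the initial values. -/
lemma IsSchemeSolution.sum_abs_sub_le {b : ℤ → ℝ} {W : ℤ → ℝ → ℝ}
    (hU : IsSchemeSolution F h a U) (hW : IsSchemeSolution F h b W) (hF : IsMonotoneFlux f M F)
    (hh : 0 < h) (hM : 0 ≤ M) (ha : ∀ i, |a i| ≤ M) (hb : ∀ i, |b i| ≤ M) {A : ℝ}
    (hA : ∀ n : ℕ, ∑ i ∈ Finset.Ico (-n : ℤ) n, |a i - b i| ≤ A) (n : ℕ) {t : ℝ} (ht : 0 ≤ t) :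
    ∑ i ∈ Finset.Ico (-n : ℤ) n, |U i t - W i t| ≤ A := by
  obtain ⟨L, hL⟩ := hF.exists_isFluxLipschitz hM
  have hUM i t (ht : 0 ≤ t) := hU.abs_le hF hh hM ha i ht
  have hWM i t (ht : 0 ≤ t) := hW.abs_le hF hh hM hb i ht
  set G : ℤ → ℝ → ℝ := fun i r => fluxGap F (fun j => U j r) (fun j => W j r) i with hG
  have hGc (i) : ContinuousOn (G i) (Ici 0) :=
    continuousOn_fluxGap hF hU.continuousOn hW.continuousOn i
  have hGb (i) (r) (hr : 0 ≤ r) : |G i r| ≤ L * (2 * M) :=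
    hL.abs_fluxGap_le (hUM · r hr) (hWM · r hr) (by positivity) fun j _ _ =>
      (abs_sub _ _).trans (by linarith [hUM j r hr, hWM j r hr])
  have hint (i) {t : ℝ} (ht : 0 ≤ t) : IntervalIntegrable (G i) volume 0 t :=
    ((hGc i).mono (by rw [uIcc_of_le ht]; exact Icc_subset_Ici_self)).intervalIntegrable
  -- The entropy fluxes telescope, leaving only those through the two ends of the window.
  have step (n : ℕ) (t : ℝ) (ht : 0 ≤ t) : ∑ i ∈ Finset.Ico (-n : ℤ) n, |U i t - W i t| ≤
      A + (∫ r in 0..t, (G (-n - 1) r - G (n - 1) r)) / h := by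
    calc ∑ i ∈ Finset.Ico (-n : ℤ) n, |U i t - W i t|
        ≤ ∑ i ∈ Finset.Ico (-n : ℤ) n, (|a i - b i| +
          ∫ r in 0..t, (G (i - 1) r - G i r) / h) := by
          refine Finset.sum_le_sum fun i _ => ?_
          rw [← hU.initial, ← hW.initial]
          exact hU.abs_sub_le_add_integral hW hF hh hUM hWM i le_rfl ht
      _ = ∑ i ∈ Finset.Ico (-n : ℤ) n, |a i - b i| +
          (∫ r in 0..t, (G (-n - 1) r - G (n - 1) r)) / h := by
          rw [Finset.sum_add_distrib, ← intervalIntegral.integral_finsetSum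
            (fun i _ => ((hint (i - 1) ht).sub (hint i ht)).div_const h),
            ← intervalIntegral.integral_div]
          congr 2
          ext r
          have := sum_Ico_int_sub (fun i => -G (i - 1) r) (a := -n) (b := n) (by lia)
          simp only [add_sub_cancel_right] at this
          rw [← Finset.sum_div]
          congr 1
          rw [show G (-n - 1) r - G (n - 1) r = -G (n - 1) r - -G (-n - 1) r by ring, ← this]
          exact Finset.sum_congr rfl fun i _ => by ring
      _ ≤ _ := by gcongr; exact hA n
  -- Bounding the end fluxes crudely gives a bound that grows in time but is uniform in the window,
  -- hence summability of the differences.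
  have hbdd (r : ℝ) (hr : 0 ≤ r) (s : Finset ℤ) :
      ∑ i ∈ s, |U i r - W i r| ≤ A + (L * (4 * M)) * r / h := by
    obtain ⟨n, hn⟩ := exists_subset_Ico_int s
    refine (Finset.sum_le_sum_of_subset_of_nonneg (t := Finset.Ico (-n : ℤ) n)
      (fun j hj => Finset.mem_Ico.2 (hn j hj)) fun _ _ _ => abs_nonneg _).trans
      ((step n r hr).trans ?_)
    gcongr
    refine (le_abs_self _).trans ?_
    have := intervalIntegral.norm_integral_le_of_norm_le_const (a := 0) (b := r)
      (f := fun r => G (-n - 1) r - G (n - 1) r) (C := L * (4 * M)) fun x hx => by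
        rw [uIoc_of_le hr] at hx
        refine (abs_sub _ _).trans ?_
        have := hGb (-n - 1) x hx.1.le
        have := hGb (n - 1) x hx.1.le
        linarith
    rwa [sub_zero, abs_of_nonneg hr, Real.norm_eq_abs] at this
  -- Summability forces the differences to vanish at infinity; so do the entropy fluxes, which are
  -- controlled by the differences over a stencil. The end terms then disappear by dominated
  -- convergence.
  have htend (r : ℝ) (hr : 0 ≤ r) : Tendsto (fun i => G i r) cofinite (𝓝 0) := by
    have hz := (summable_of_sum_le (fun i => abs_nonneg (U i r - W i r))
      (hbdd r hr)).tendsto_cofinite_zero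
    rw [Metric.tendsto_nhds]
    intro ε hε
    set σ := ε / (L + 1)
    have hL0 := hL.1
    have hσ : 0 < σ := by positivity
    have hev := hz.eventually_lt_const hσ
    obtain ⟨n, hn⟩ := exists_subset_Ico_int (Filter.eventually_cofinite.1 hev).toFinset
    have hev2 : ∀ᶠ i : ℤ in cofinite, i ∉ Finset.Icc (-n - p : ℤ) (n + p) :=
      (Finset.finite_toSet (Finset.Icc (-n - p : ℤ) (n + p))).eventually_cofinite_notMem
    filter_upwards [hev2] with i hi
    rw [dist_zero_right, Real.norm_eq_abs]
    refine (hL.abs_fluxGap_le (hUM · r hr) (hWM · r hr) hσ.le fun j h1 h2 => ?_).trans_lt ?_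
    · by_contra hcon
      have := hn j (by simpa using (not_le.1 hcon).le)
      rw [Finset.mem_Icc] at hi
      lia
    · rw [mul_div_assoc', div_lt_iff₀ (by positivity)]
      nlinarith
  have hlim : Tendsto (fun n : ℕ => A + (∫ r in 0..t, (G (-n - 1) r - G (n - 1) r)) / h) atTop
      (𝓝 (A + (∫ r in 0..t, (0 : ℝ)) / h)) := by
    refine tendsto_const_nhds.add (Tendsto.div_const ?_ h)
    refine intervalIntegral.tendsto_integral_filter_of_dominated_convergence
      (fun _ => L * (4 * M)) (Eventually.of_forall fun n => ?_) (Eventually.of_forall fun n => ?_)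
      intervalIntegrable_const ?_
    · exact ((hint _ ht).sub (hint _ ht)).aestronglyMeasurable_restrict_uIoc
    · refine Eventually.of_forall fun x hx => ?_
      rw [uIoc_of_le ht] at hx
      refine (abs_sub _ _).trans ?_
      have := hGb (-n - 1) x hx.1.le
      have := hGb (n - 1) x hx.1.le
      linarith
    · refine Eventually.of_forall fun x hx => ?_
      rw [uIoc_of_le ht] at hx
      rw [← sub_zero (0 : ℝ)]
      refine ((htend x hx.1.le).comp ?_).sub ((htend x hx.1.le).comp ?_)
      · refine Nat.cofinite_eq_atTop ▸ Function.Injective.tendsto_cofinite fun m n hmn => ?_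
        simpa using hmn
      · refine Nat.cofinite_eq_atTop ▸ Function.Injective.tendsto_cofinite fun m n hmn => ?_
        simpa using hmn
  rw [intervalIntegral.integral_zero, zero_div, add_zero] at hlim
  refine ge_of_tendsto hlim ?_
  filter_upwards [eventually_ge_atTop n] with m hm
  refine le_trans ?_ (step m t ht)
  refine Finset.sum_le_sum_of_subset_of_nonneg (fun j hj => ?_) fun _ _ _ => abs_nonneg _
  rw [Finset.mem_Ico] at hj ⊢
  lia

/-- The bound is `max V 0` because `ENNReal.ofReal` sends negative `V` to zero. -/
lemma sum_abs_sub_le_of_eVariationOn_le {V : ℝ} (hV : eVariationOn a univ ≤ ENNReal.ofReal V)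
    (n : ℕ) : ∑ i ∈ Finset.Ico (-n : ℤ) n, |a (i + 1) - a i| ≤ max V 0 := by
  have h1 := eVariationOn.sum_le (f := a) (s := univ) (n := 2 * n) (u := fun k : ℕ => -(n : ℤ) + k)
    (fun k l hkl => by simpa using hkl) fun _ => mem_univ _
  have h2 := sum_Ico_int (fun i => |a (i + 1) - a i|) (-n) (2 * n)
  rw [show -(n : ℤ) + (2 * n : ℕ) = n by push_cast; ring] at h2
  rw [h2, ← ENNReal.toReal_ofReal', ← ENNReal.ofReal_le_iff_le_toReal ENNReal.ofReal_ne_top,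
    ENNReal.ofReal_sum_of_nonneg fun _ _ => abs_nonneg _]
  refine le_trans (le_of_eq ?_) (h1.trans hV)
  refine Finset.sum_congr rfl fun k _ => ?_
  rw [edist_dist, Real.dist_eq]
  push_cast
  ring_nf

/-- The scheme does not increase the total variation. -/
lemma IsSchemeSolution.sum_abs_sub_succ_le (hU : IsSchemeSolution F h a U)
    (hF : IsMonotoneFlux f M F) (hh : 0 < h) (hM : 0 ≤ M) (ha : ∀ i, |a i| ≤ M) {V : ℝ}
    (hV : eVariationOn a univ ≤ ENNReal.ofReal V) {t : ℝ} (ht : 0 ≤ t) (s : Finset ℤ) :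
    ∑ i ∈ s, |U (i + 1) t - U i t| ≤ max V 0 := by
  obtain ⟨n, hn⟩ := exists_subset_Ico_int s
  refine (Finset.sum_le_sum_of_subset_of_nonneg (t := Finset.Ico (-n : ℤ) n)
      (fun j hj => Finset.mem_Ico.2 (hn j hj)) fun _ _ _ => abs_nonneg _).trans ?_
  -- The shifted solution solves the same scheme, so the jumps are differences of two solutions and
  -- the contraction applies.
  exact hU.shift.sum_abs_sub_le hU hF hh hM (fun _ => ha _) ha
    (sum_abs_sub_le_of_eVariationOn_le hV) n ht

/-- Every grid value is Lipschitz in time, uniformly in the cell. -/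
lemma IsSchemeSolution.exists_lipschitz (hU : IsSchemeSolution F h a U)
    (hF : IsMonotoneFlux f M F) (hh : 0 < h) (hM : 0 ≤ M) (ha : ∀ i, |a i| ≤ M) :
    ∃ Λ, 0 ≤ Λ ∧ ∀ i, ∀ s t, 0 ≤ s → 0 ≤ t → |U i t - U i s| ≤ Λ * |t - s| := by
  obtain ⟨L, hL⟩ := hF.exists_isFluxLipschitz hM
  have hL0 := hL.1
  refine ⟨2 * L * M / h, by positivity, fun i => ?_⟩
  have key (s t : ℝ) (hs : 0 ≤ s) (hst : s ≤ t) : |U i t - U i s| ≤ 2 * L * M / h * |t - s| := by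
    rw [abs_of_nonneg (sub_nonneg.2 hst)]
    refine norm_image_sub_le_of_norm_deriv_right_le_segment (f := U i)
      (f' := fun r => schemeRHS F h (fun j => U j r) i)
      ((hU.continuousOn i).mono fun x hx => hs.trans hx.1)
      (fun x hx => hU.hasDerivWithinAt hF i (hs.trans hx.1)) (fun x hx => ?_) t
      (right_mem_Icc.2 hst)
    have hx0 := hs.trans hx.1
    -- The rate is compared with that of the zero grid function, which vanishes.
    have := hL.abs_schemeRHS_sub_le (i := i) (w := fun _ => 0) hh
      (fun j => hU.abs_le hF hh hM ha j hx0) (fun _ => by simpa) hM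
      (fun j => by simpa using hU.abs_le hF hh hM ha j hx0)
    rwa [schemeRHS_const hF, sub_zero] at this
  intro s t hs ht
  rcases le_total s t with hst | hst
  · exact key s t hs hst
  · rw [abs_sub_comm, abs_sub_comm t]
    exact key t s ht hst

end Flux

/-! ### Kruzhkov's entropies -/

/-- The entropy flux of the entropy `x ↦ |x - k|`. -/
def kruzkovFlux (f : ℝ → ℝ) (x k : ℝ) : ℝ := f (max x k) - f (min x k)

lemma ContDiff.exists_lipschitz_Icc {f : ℝ → ℝ} (hf : ContDiff ℝ 1 f) (B : ℝ) :
    ∃ L, 0 ≤ L ∧ ∀ x y, |x| ≤ B → |y| ≤ B → |f x - f y| ≤ L * |x - y| := by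
  obtain ⟨L, hL⟩ := (isCompact_Icc (a := -B) (b := B)).exists_bound_of_continuousOn
    (hf.continuous_deriv le_rfl).continuousOn
  refine ⟨max L 0, le_max_right _ _, fun x y hx hy => ?_⟩
  exact (convex_Icc (-B) B).norm_image_sub_le_of_norm_deriv_le (f := f)
    (fun z _ => (hf.differentiable one_ne_zero) z)
    (fun z hz => (hL z hz).trans (le_max_left _ _)) (abs_le.1 hy) (abs_le.1 hx)

lemma abs_kruzkovFlux_le {f : ℝ → ℝ} {B L : ℝ}
    (hL : ∀ x y, |x| ≤ B → |y| ≤ B → |f x - f y| ≤ L * |x - y|) {x k : ℝ}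
    (hx : |x| ≤ B) (hk : |k| ≤ B) : |kruzkovFlux f x k| ≤ L * |x - k| := by
  have := hL (max x k) (min x k) (abs_max_le_of hx hk) (abs_min_le_of hx hk)
  rwa [max_sub_min_eq_abs', abs_abs] at this

lemma abs_kruzkovFlux_sub_le {f : ℝ → ℝ} {B L : ℝ} (hL0 : 0 ≤ L)
    (hL : ∀ x y, |x| ≤ B → |y| ≤ B → |f x - f y| ≤ L * |x - y|) {x k k' : ℝ}
    (hx : |x| ≤ B) (hk : |k| ≤ B) (hk' : |k'| ≤ B) :
    |kruzkovFlux f x k - kruzkovFlux f x k'| ≤ 2 * L * |k - k'| := by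
  have h1 := hL (max x k) (max x k') (abs_max_le_of hx hk) (abs_max_le_of hx hk')
  have h2 := hL (min x k) (min x k') (abs_min_le_of hx hk) (abs_min_le_of hx hk')
  have h3 : L * |max x k - max x k'| ≤ L * |k - k'| :=
    mul_le_mul_of_nonneg_left (by simpa using abs_max_sub_max_le_max x k x k') hL0
  have h4 : L * |min x k - min x k'| ≤ L * |k - k'| :=
    mul_le_mul_of_nonneg_left (by simpa using abs_min_sub_min_le_max x k x k') hL0
  have h5 : kruzkovFlux f x k - kruzkovFlux f x k' =
      (f (max x k) - f (max x k')) - (f (min x k) - f (min x k')) := by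
    unfold kruzkovFlux; ring
  rw [h5]
  refine (abs_sub _ _).trans ?_
  linarith

@[fun_prop]
lemma Continuous.kruzkovFlux {X : Type*} [TopologicalSpace X] {f : ℝ → ℝ} (hf : Continuous f)
    {g k : X → ℝ} (hg : Continuous g) (hk : Continuous k) :
    Continuous fun x => kruzkovFlux f (g x) (k x) := by
  unfold _root_.kruzkovFlux; fun_prop

lemma isEntropyPair_abs_sub {f : ℝ → ℝ} (hf : ContDiff ℝ 1 f) (k : ℝ) :
    IsEntropyPair f (fun x => |x - k|) (fun x => kruzkovFlux f x k) := by
  refine ⟨?_, fun a b => ?_⟩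
  · have := (convexOn_norm (E := ℝ) convex_univ).translate_right (-k)
    simpa [Function.comp_def, neg_add_eq_sub] using this
  have hderiv (x : ℝ) : deriv (fun x => |x - k|) x = SignType.sign (x - k) := by
    rw [deriv_comp_sub_const (fun x => |x|), deriv_abs]
  have hfd : Differentiable ℝ f := hf.differentiable one_ne_zero
  have hfi (a b : ℝ) : IntervalIntegrable (deriv f) volume a b :=
    (hf.continuous_deriv le_rfl).intervalIntegrable a b
  -- Integrals start at the corner `k`, where the entropy flux vanishes; on either side the sign of
  -- `ξ - k` is constant.
  have key (b : ℝ) : IntervalIntegrable (fun ξ => deriv (fun x => |x - k|) ξ * deriv f ξ)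
      volume k b ∧ ∫ ξ in k..b, deriv (fun x => |x - k|) ξ * deriv f ξ = kruzkovFlux f b k := by
    rcases le_total k b with hb | hb
    · have he : EqOn (deriv f) (fun ξ => deriv (fun x => |x - k|) ξ * deriv f ξ) (uIoo k b) := by
        intro x hx
        rw [uIoo_of_le hb] at hx
        simp only [hderiv, sign_pos (sub_pos.2 hx.1)]
        simp
      refine ⟨(hfi k b).congr_uIoo he, ?_⟩
      rw [← intervalIntegral.integral_congr_uIoo he,
        intervalIntegral.integral_deriv_eq_sub (fun x _ => hfd x) (hfi k b), kruzkovFlux,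
        max_eq_left hb, min_eq_right hb]
    · have he : EqOn (fun x => -deriv f x) (fun ξ => deriv (fun x => |x - k|) ξ * deriv f ξ)
          (uIoo k b) := by
        intro x hx
        rw [uIoo_of_ge hb] at hx
        simp only [hderiv, sign_neg (sub_neg.2 hx.2)]
        simp
      refine ⟨(hfi k b).neg.congr_uIoo he, ?_⟩
      rw [← intervalIntegral.integral_congr_uIoo he, intervalIntegral.integral_neg,
        intervalIntegral.integral_deriv_eq_sub (fun x _ => hfd x) (hfi k b), kruzkovFlux,
        max_eq_right hb, min_eq_left hb, neg_sub]
  simp only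
  rw [← (key a).2, ← (key b).2, intervalIntegral.integral_interval_sub_left (key b).1 (key a).1]

/-! ### Test functions -/

lemma continuous_dt {φ : ℝ × ℝ → ℝ} (hφ : ContDiff ℝ 1 φ) : Continuous (dt φ) :=
  (hφ.continuous_fderiv one_ne_zero).clm_apply continuous_const

lemma continuous_dx {φ : ℝ × ℝ → ℝ} (hφ : ContDiff ℝ 1 φ) : Continuous (dx φ) :=
  (hφ.continuous_fderiv one_ne_zero).clm_apply continuous_const

lemma dt_eq_zero {φ : ℝ × ℝ → ℝ} {z : ℝ × ℝ} (hz : z ∉ tsupport φ) : dt φ z = 0 := by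
  rw [dt, fderiv_of_notMem_tsupport ℝ hz]; rfl

lemma dx_eq_zero {φ : ℝ × ℝ → ℝ} {z : ℝ × ℝ} (hz : z ∉ tsupport φ) : dx φ z = 0 := by
  rw [dx, fderiv_of_notMem_tsupport ℝ hz]; rfl

lemma dt_mul {φ ψ : ℝ × ℝ → ℝ} (hφ : ContDiff ℝ 1 φ) (hψ : ContDiff ℝ 1 ψ) (z : ℝ × ℝ) :
    dt (fun z => φ z * ψ z) z = dt φ z * ψ z + φ z * dt ψ z := by
  unfold dt
  rw [fderiv_fun_mul (hφ.differentiable one_ne_zero z) (hψ.differentiable one_ne_zero z)]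
  simp
  ring

lemma dx_mul {φ ψ : ℝ × ℝ → ℝ} (hφ : ContDiff ℝ 1 φ) (hψ : ContDiff ℝ 1 ψ) (z : ℝ × ℝ) :
    dx (fun z => φ z * ψ z) z = dx φ z * ψ z + φ z * dx ψ z := by
  unfold dx
  rw [fderiv_fun_mul (hφ.differentiable one_ne_zero z) (hψ.differentiable one_ne_zero z)]
  simp
  ring

/-- Derivatives of a function of an affine combination `l z`. -/
lemma fderiv_comp_affine {g : ℝ → ℝ} {g' : ℝ} (l : ℝ × ℝ →L[ℝ] ℝ) (c : ℝ) {z : ℝ × ℝ}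
    (hg : HasDerivAt g g' (l z + c)) (w : ℝ × ℝ) :
    fderiv ℝ (fun z => g (l z + c)) z w = g' * l w := by
  have := hg.comp_hasFDerivAt z (l.hasFDerivAt.add_const c)
  rw [HasFDerivAt.fderiv (f := fun z => g (l z + c)) this]
  simp

lemma dt_comp_snd {g : ℝ → ℝ} {g' : ℝ} {z : ℝ × ℝ} (hg : HasDerivAt g g' z.2) :
    dt (fun z => g z.2) z = g' := by
  have := fderiv_comp_affine (ContinuousLinearMap.snd ℝ ℝ ℝ) 0 (g := g) (g' := g') (z := z)
    (by simpa using hg) (0, 1)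
  simpa [dt, dx] using this

lemma dx_comp_snd {g : ℝ → ℝ} {g' : ℝ} {z : ℝ × ℝ} (hg : HasDerivAt g g' z.2) :
    dx (fun z => g z.2) z = 0 := by
  have := fderiv_comp_affine (ContinuousLinearMap.snd ℝ ℝ ℝ) 0 (g := g) (g' := g') (z := z)
    (by simpa using hg) (1, 0)
  simpa [dt, dx] using this

lemma dt_comp_fst {g : ℝ → ℝ} {g' : ℝ} {z : ℝ × ℝ} (hg : HasDerivAt g g' z.1) :
    dt (fun z => g z.1) z = 0 := by
  have := fderiv_comp_affine (ContinuousLinearMap.fst ℝ ℝ ℝ) 0 (g := g) (g' := g') (z := z)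
    (by simpa using hg) (0, 1)
  simpa [dt, dx] using this

lemma dx_comp_fst {g : ℝ → ℝ} {g' : ℝ} {z : ℝ × ℝ} (hg : HasDerivAt g g' z.1) :
    dx (fun z => g z.1) z = g' := by
  have := fderiv_comp_affine (ContinuousLinearMap.fst ℝ ℝ ℝ) 0 (g := g) (g' := g') (z := z)
    (by simpa using hg) (1, 0)
  simpa [dt, dx] using this

lemma IsTestFunction.mul_right {φ ψ : ℝ × ℝ → ℝ} (hφ : IsTestFunction φ) (hψ : ContDiff ℝ 1 ψ) :
    IsTestFunction fun z => φ z * ψ z :=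
  ⟨hφ.1.mul hψ, hφ.2.mul_right⟩

lemma IsTestFunction.integrable {φ : ℝ × ℝ → ℝ} (hφ : IsTestFunction φ)
    (μ : Measure (ℝ × ℝ)) [IsFiniteMeasureOnCompacts μ] : Integrable φ μ :=
  hφ.1.continuous.integrable_of_hasCompactSupport hφ.2

lemma IsTestFunction.integrable_dt {φ : ℝ × ℝ → ℝ} (hφ : IsTestFunction φ)
    (μ : Measure (ℝ × ℝ)) [IsFiniteMeasureOnCompacts μ] : Integrable (dt φ) μ :=
  (continuous_dt hφ.1).integrable_of_hasCompactSupport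
    (hφ.2.mono' fun _ hz => by_contra fun h => hz (dt_eq_zero h))

lemma IsTestFunction.integrable_dx {φ : ℝ × ℝ → ℝ} (hφ : IsTestFunction φ)
    (μ : Measure (ℝ × ℝ)) [IsFiniteMeasureOnCompacts μ] : Integrable (dx φ) μ :=
  (continuous_dx hφ.1).integrable_of_hasCompactSupport
    (hφ.2.mono' fun _ hz => by_contra fun h => hz (dx_eq_zero h))

lemma IsTestFunction.integrable_initial {φ : ℝ × ℝ → ℝ} (hφ : IsTestFunction φ) :
    Integrable fun x => φ (x, 0) := by
  have he : Topology.IsClosedEmbedding fun x : ℝ => (x, (0 : ℝ)) :=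
    Topology.IsClosedEmbedding.of_continuous_injective_isClosedMap (by fun_prop)
      (fun x y h => (Prod.ext_iff.1 h).1) (isClosedMap_prodMk_right 0)
  exact (hφ.1.continuous.comp he.continuous).integrable_of_hasCompactSupport
    (hφ.2.comp_isClosedEmbedding he)

/-! ### A partition of unity in time -/

/-- The weights of a `C¹` partition of unity of `[0, ∞)` of mesh width `τ`. -/
def timeWeight (τ : ℝ) (n : ℕ) (s : ℝ) : ℝ :=
  smoothStep (s / τ - n + 2) - smoothStep (s / τ - n + 1)

/-- The derivative of `timeWeight`. -/
def timeWeightDeriv (τ : ℝ) (n : ℕ) (s : ℝ) : ℝ :=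
  (hat (s / τ - n + 2) - hat (s / τ - n + 1)) / τ

lemma hasDerivAt_timeWeight (τ : ℝ) (n : ℕ) (s : ℝ) :
    HasDerivAt (timeWeight τ n) (timeWeightDeriv τ n s) s := by
  have h (c : ℝ) : HasDerivAt (fun s => smoothStep (s / τ - n + c))
      (hat (s / τ - n + c) * (1 / τ)) s :=
    (hasDerivAt_smoothStep _).comp s ((((hasDerivAt_id s).div_const τ).sub_const _).add_const c)
  refine ((h 2).sub (h 1)).congr_deriv ?_
  unfold timeWeightDeriv
  ring

lemma contDiff_timeWeight (τ : ℝ) (n : ℕ) : ContDiff ℝ 1 (timeWeight τ n) := by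
  unfold timeWeight
  exact (contDiff_smoothStep.comp (by fun_prop)).sub (contDiff_smoothStep.comp (by fun_prop))

lemma timeWeight_nonneg (τ : ℝ) (n : ℕ) (s : ℝ) : 0 ≤ timeWeight τ n s :=
  sub_nonneg.2 (smoothStep_monotone (by linarith))

lemma abs_sub_le_of_timeWeight_ne_zero {τ : ℝ} (hτ : 0 < τ) {n : ℕ} {s : ℝ}
    (h : timeWeight τ n s ≠ 0) : |n * τ - s| ≤ 2 * τ := by
  have h1 : 0 < s / τ - n + 2 := by
    by_contra! h1
    exact h (by rw [timeWeight, smoothStep_of_nonpos h1, smoothStep_of_nonpos (by linarith),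
      sub_zero])
  have h2 : s / τ - n + 1 < 2 := by
    by_contra! h2
    exact h (by rw [timeWeight, smoothStep_of_two_le h2, smoothStep_of_two_le (by linarith),
      sub_self])
  have h3 : s = s / τ * τ := by field_simp
  rw [h3, ← sub_mul, abs_mul, abs_of_pos hτ]
  gcongr
  rw [abs_le]
  constructor <;> linarith

/-- The sum telescopes. The offset `2` makes the first step already equal to `1` for all `s ≥ 0`, so
the partition includes the initial time. -/
lemma sum_timeWeight {τ : ℝ} (hτ : 0 < τ) {N : ℕ} {s : ℝ} (hs : 0 ≤ s) (hN : s / τ + 2 ≤ N) :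
    ∑ n ∈ Finset.range N, timeWeight τ n s = 1 := by
  have h := Finset.sum_range_sub' (fun n : ℕ => smoothStep (s / τ - n + 2)) N
  have h0 : 0 ≤ s / τ := by positivity
  rw [smoothStep_of_two_le (by simpa), smoothStep_of_nonpos (x := s / τ - N + 2) (by linarith),
    sub_zero] at h
  rw [← h]
  refine Finset.sum_congr rfl fun n _ => ?_
  rw [timeWeight]
  congr 2
  push_cast; ring

/-- Summation by parts against the time weights. -/
lemma sum_timeWeightDeriv_mul_le {τ : ℝ} (hτ : 0 < τ) {N : ℕ} {s : ℝ} (hs : 0 ≤ s)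
    (hN : s / τ + 2 ≤ N) {ζ : ℝ → ℝ} {g : ℝ → ℝ} {Λ : ℝ} (hΛ : 0 ≤ Λ) (hg : Continuous g)
    (hgl : ∀ r, 0 ≤ r → |g r - g s| ≤ Λ * |r - s|)
    (hζ : ∀ a b, 0 ≤ a → a ≤ b → ζ b - ζ a ≤ ∫ r in a..b, g r) :
    ∑ n ∈ Finset.range N, timeWeightDeriv τ n s * ζ (n * τ) ≤ g s + 2 * Λ * τ := by
  have h0 : 0 ≤ s / τ := by positivity
  set κ : ℕ → ℝ := fun n => hat (s / τ - n + 2) with hκ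
  have hsum : ∑ n ∈ Finset.range N, κ (n + 1) = 1 := by
    -- The reflection `hat (2 - x) = hat x` turns the decreasing translates into increasing ones.
    rw [← sum_range_hat (1 - s / τ) N (by linarith) (by linarith)]
    refine Finset.sum_congr rfl fun n _ => ?_
    simp only [hκ, hat]
    push_cast
    rw [show s / τ - (n + 1) + 2 = 2 - (1 - s / τ + n) by ring]
    generalize 1 - s / τ + (n : ℝ) = x
    grind
  -- Abel summation moves the difference onto `ζ`; the boundary terms vanish since `κ 0 = κ N = 0`.
  -- What remains is an average of difference quotients of `ζ` on intervals within `2τ` of `s`.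
  have habel : ∑ n ∈ Finset.range N, timeWeightDeriv τ n s * ζ (n * τ) =
      ∑ n ∈ Finset.range N, κ (n + 1) * ((ζ ((n + 1 : ℕ) * τ) - ζ (n * τ)) / τ) := by
    have h := Finset.sum_range_sub' (fun n : ℕ => κ n * ζ (n * τ) / τ) N
    have hκ0 : κ 0 = 0 := hat_of_two_le (by simpa)
    have hκN : κ N = 0 := hat_of_nonpos (by linarith)
    rw [hκ0, hκN, zero_mul, zero_mul, sub_self] at h
    rw [← sub_eq_zero, ← Finset.sum_sub_distrib, ← h]
    refine Finset.sum_congr rfl fun n _ => ?_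
    have : timeWeightDeriv τ n s = (κ n - κ (n + 1)) / τ := by
      simp only [timeWeightDeriv, hκ]
      congr 3
      push_cast; ring
    rw [this]
    ring
  rw [habel]
  calc _ ≤ ∑ n ∈ Finset.range N, κ (n + 1) * (g s + 2 * Λ * τ) := by
        refine Finset.sum_le_sum fun n _ => ?_
        by_cases hn : κ (n + 1) = 0
        · simp [hn]
        refine mul_le_mul_of_nonneg_left ?_ (hat_nonneg _)
        have h1 : s / τ < n + 1 := by
          by_contra! h1
          exact hn (hat_of_two_le (by push_cast; linarith))
        have h2 : n - 1 < s / τ := by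
          by_contra! h2
          exact hn (hat_of_nonpos (by push_cast; linarith))
        rw [div_lt_iff₀ hτ] at h1
        rw [lt_div_iff₀ hτ] at h2
        have hn0 : 0 ≤ n * τ := by positivity
        have hn1 : n * τ ≤ (n + 1 : ℕ) * τ := by gcongr; simp
        have hlen : ((n + 1 : ℕ) : ℝ) * τ - n * τ = τ := by push_cast; ring
        rw [div_le_iff₀ hτ]
        refine (hζ _ _ hn0 hn1).trans ?_
        have := intervalIntegral.integral_mono_on hn1 (hg.intervalIntegrable _ _)
          (intervalIntegrable_const (c := g s + 2 * Λ * τ) (μ := volume)) fun r hr => by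
          have h3 := (abs_le.1 (hgl r (hn0.trans hr.1))).2
          have h4 : |r - s| ≤ 2 * τ := by
            have := hr.1
            have := hr.2
            rw [abs_le]
            constructor <;> push_cast at * <;> linarith
          have := mul_le_mul_of_nonneg_left h4 hΛ
          linarith
        rw [intervalIntegral.integral_const, hlen, smul_eq_mul] at this
        linarith
    _ = g s + 2 * Λ * τ := by rw [← Finset.sum_mul, hsum, one_mul]

/-! ### Kruzhkov's inequality with a time-dependent constant -/

lemma integrable_pairing {φ : ℝ × ℝ → ℝ} (hφ : IsTestFunction φ) {A B C : ℝ × ℝ → ℝ} {R : ℝ}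
    {μ : Measure (ℝ × ℝ)} [IsFiniteMeasureOnCompacts μ] (hA : AEStronglyMeasurable A μ)
    (hB : AEStronglyMeasurable B μ) (hC : AEStronglyMeasurable C μ) (hAR : ∀ᵐ z ∂μ, |A z| ≤ R)
    (hBR : ∀ᵐ z ∂μ, |B z| ≤ R) (hCR : ∀ᵐ z ∂μ, |C z| ≤ R) :
    Integrable (fun z => dt φ z * A z + dx φ z * B z + φ z * C z) μ :=
  (((hφ.integrable_dt μ).mul_bdd hA hAR).add ((hφ.integrable_dx μ).mul_bdd hB hBR)).add
    ((hφ.integrable μ).mul_bdd hC hCR)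

instance : IsFiniteMeasureOnCompacts (volume.restrict spaceTime) :=
  isFiniteMeasureOnCompacts_of_isLocallyFiniteMeasure

lemma measurableSet_spaceTime : MeasurableSet spaceTime :=
  MeasurableSet.univ.prod measurableSet_Ici

/-- Only the essential bound of `u` itself is used, which may exceed `M`; it is enlarged so as to
cover the grid values too. -/
lemma IsEntropySolution.exists_bound {f u₀ : ℝ → ℝ} {u : ℝ × ℝ → ℝ}
    (hu : IsEntropySolution f u₀ u) (M : ℝ) :
    ∃ B, M ≤ B ∧ ∀ᵐ z ∂volume.restrict spaceTime, |u z| ≤ B := by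
  have h := hu.1.1.eLpNorm_lt_top
  rw [eLpNorm_exponent_top] at h
  refine ⟨max M (eLpNormEssSup u (volume.restrict spaceTime)).toReal, le_max_left _ _, ?_⟩
  filter_upwards [ae_le_eLpNormEssSup (f := u) (μ := volume.restrict spaceTime)] with z hz
  refine le_trans ?_ (le_max_right _ _)
  rw [← Real.norm_eq_abs, ← toReal_enorm]
  exact ENNReal.toReal_mono h.ne hz

/-- The quantities produced by testing with `φ` times the time weights, at a fixed point. -/
lemma sum_timeWeight_pairing_le {f : ℝ → ℝ} {B L : ℝ} (hL0 : 0 ≤ L)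
    (hL : ∀ x y, |x| ≤ B → |y| ≤ B → |f x - f y| ≤ L * |x - y|)
    {k : ℝ → ℝ} {Λ : ℝ} (hΛ : 0 ≤ Λ) (hk : ∀ s t, 0 ≤ s → 0 ≤ t → |k t - k s| ≤ Λ * |t - s|)
    (hkB : ∀ t, |k t| ≤ B) {c : ℝ} (hc : |c| ≤ B) {g : ℝ → ℝ} {s : ℝ} (hs : 0 ≤ s)
    (hg : Continuous g) (hgl : ∀ r, 0 ≤ r → |g r - g s| ≤ Λ * |r - s|)
    (hgk : ∀ a b, 0 ≤ a → a ≤ b → |c - k b| - |c - k a| ≤ ∫ r in a..b, g r)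
    {τ : ℝ} (hτ : 0 < τ) {N : ℕ} (hN : s / τ + 2 ≤ N) (ϕ ϕt ϕx : ℝ) (hϕ : 0 ≤ ϕ) :
    ∑ n ∈ Finset.range N, ((ϕt * timeWeight τ n s + ϕ * timeWeightDeriv τ n s) * |c - k (n * τ)| +
      ϕx * timeWeight τ n s * kruzkovFlux f c (k (n * τ))) ≤
    ϕt * |c - k s| + ϕx * kruzkovFlux f c (k s) + ϕ * g s +
      τ * ((4 * L + 2) * Λ * (|ϕt| + |ϕx| + ϕ)) := by
  have hsum := sum_timeWeight hτ hs hN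
  have hd := mul_le_mul_of_nonneg_left
    (sum_timeWeightDeriv_mul_le hτ hs hN hΛ hg hgl (ζ := fun t => |c - k t|) hgk) hϕ
  have hknear (n : ℕ) (hn : timeWeight τ n s ≠ 0) : |k (n * τ) - k s| ≤ 2 * Λ * τ := by
    refine (hk s (n * τ) hs (by positivity)).trans ?_
    have := mul_le_mul_of_nonneg_left (abs_sub_le_of_timeWeight_ne_zero hτ hn) hΛ
    linarith
  have ht : ∑ n ∈ Finset.range N, timeWeight τ n s * (ϕt * |c - k (n * τ)|) ≤
      ∑ n ∈ Finset.range N, timeWeight τ n s * (ϕt * |c - k s| + |ϕt| * (2 * Λ * τ)) := by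
    refine Finset.sum_le_sum fun n _ => ?_
    by_cases hn : timeWeight τ n s = 0
    · simp [hn]
    refine mul_le_mul_of_nonneg_left ?_ (timeWeight_nonneg _ _ _)
    have h1 : ϕt * (|c - k (n * τ)| - |c - k s|) ≤ |ϕt| * |k (n * τ) - k s| := by
      refine (le_abs_self _).trans ?_
      rw [abs_mul]
      refine mul_le_mul_of_nonneg_left ?_ (abs_nonneg _)
      refine (abs_abs_sub_abs_le (c - k (n * τ)) (c - k s)).trans_eq ?_
      rw [abs_sub_comm]
      congr 1
      ring
    have h2 := mul_le_mul_of_nonneg_left (hknear n hn) (abs_nonneg ϕt)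
    linarith
  have hx : ∑ n ∈ Finset.range N, timeWeight τ n s * (ϕx * kruzkovFlux f c (k (n * τ))) ≤
      ∑ n ∈ Finset.range N, timeWeight τ n s *
        (ϕx * kruzkovFlux f c (k s) + |ϕx| * (2 * L * (2 * Λ * τ))) := by
    refine Finset.sum_le_sum fun n _ => ?_
    by_cases hn : timeWeight τ n s = 0
    · simp [hn]
    refine mul_le_mul_of_nonneg_left ?_ (timeWeight_nonneg _ _ _)
    have h1 : ϕx * (kruzkovFlux f c (k (n * τ)) - kruzkovFlux f c (k s)) ≤
        |ϕx| * (2 * L * (2 * Λ * τ)) := by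
      refine (le_abs_self _).trans ?_
      rw [abs_mul]
      gcongr
      refine (abs_kruzkovFlux_sub_le hL0 hL hc (hkB _) (hkB _)).trans ?_
      gcongr
      exact hknear n hn
    linarith
  rw [← Finset.sum_mul, hsum, one_mul] at ht hx
  have hsplit : ∑ n ∈ Finset.range N,
      ((ϕt * timeWeight τ n s + ϕ * timeWeightDeriv τ n s) * |c - k (n * τ)| +
        ϕx * timeWeight τ n s * kruzkovFlux f c (k (n * τ))) =
      ∑ n ∈ Finset.range N, timeWeight τ n s * (ϕt * |c - k (n * τ)|) +
      ∑ n ∈ Finset.range N, timeWeight τ n s * (ϕx * kruzkovFlux f c (k (n * τ))) +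
      ϕ * ∑ n ∈ Finset.range N, timeWeightDeriv τ n s * |c - k (n * τ)| := by
    rw [Finset.mul_sum, ← Finset.sum_add_distrib, ← Finset.sum_add_distrib]
    exact Finset.sum_congr rfl fun n _ => by ring
  rw [hsplit]
  have e1 : 0 ≤ τ * (4 * L * Λ * |ϕt|) := by positivity
  have e2 : 0 ≤ τ * (2 * Λ * |ϕx|) := by positivity
  have e3 : 0 ≤ τ * (4 * L * Λ * ϕ) := by positivity
  linarith

/-- Kruzhkov's inequality for an entropy solution `u` and a time-dependent constant `k`, along
which `|c - k|` grows at most at the rate `G c`. -/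
lemma IsEntropySolution.kruzkov_time_dependent {f u₀ : ℝ → ℝ} {u : ℝ × ℝ → ℝ}
    (hu : IsEntropySolution f u₀ u) (hf : ContDiff ℝ 1 f) (hum : Measurable u)
    (hu₀m : Measurable u₀) {M : ℝ} (hu₀ : ∀ᵐ x, |u₀ x| ≤ M) {k : ℝ → ℝ} (hkc : Continuous k)
    (hkM : ∀ t, |k t| ≤ M) {Λ : ℝ} (hΛ : 0 ≤ Λ)
    (hk : ∀ s t, 0 ≤ s → 0 ≤ t → |k t - k s| ≤ Λ * |t - s|) {G : ℝ → ℝ → ℝ} {Γ : ℝ}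
    (hG : Continuous (Function.uncurry G)) (hGb : ∀ c t, |G c t| ≤ Γ)
    (hGl : ∀ c s t, 0 ≤ s → 0 ≤ t → |G c t - G c s| ≤ Λ * |t - s|)
    (hGk : ∀ c s t, 0 ≤ s → s ≤ t → |c - k t| - |c - k s| ≤ ∫ r in s..t, G c r)
    {φ : ℝ × ℝ → ℝ} (hφ : IsTestFunction φ) (hφ0 : ∀ z ∈ spaceTime, 0 ≤ φ z) :
    IntegrableOn (fun z => dt φ z * |u z - k z.2| + dx φ z * kruzkovFlux f (u z) (k z.2) +
      φ z * G (u z) z.2) spaceTime ∧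
    (Integrable fun x => φ (x, 0) * |u₀ x - k 0|) ∧
    0 ≤ (∫ z in spaceTime, (dt φ z * |u z - k z.2| + dx φ z * kruzkovFlux f (u z) (k z.2) +
      φ z * G (u z) z.2)) + ∫ x, φ (x, 0) * |u₀ x - k 0| := by
  obtain ⟨B, hMB, huB⟩ := hu.exists_bound M
  obtain ⟨L, hL0, hL⟩ := hf.exists_lipschitz_Icc B
  have hkB (t) : |k t| ≤ B := (hkM t).trans hMB
  have hΓ0 : 0 ≤ Γ := (abs_nonneg _).trans (hGb 0 0)
  have hB0 : 0 ≤ B := (abs_nonneg _).trans (hkB 0)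
  set μ := volume.restrict spaceTime with hμ
  have hfc := hf.continuous
  -- integrability
  set R := 2 * B + L * (2 * B) + Γ with hR
  have hLB : 0 ≤ L * (2 * B) := by positivity
  have habs {c r : ℝ} (hc : |c| ≤ B) (hr : |r| ≤ B) : |c - r| ≤ 2 * B :=
    (abs_sub _ _).trans (by linarith)
  have hbA (κ : ℝ × ℝ → ℝ) (hκ : ∀ z, |κ z| ≤ B) : ∀ᵐ z ∂μ, |(|u z - κ z|)| ≤ R := by
    filter_upwards [huB] with z hz
    rw [abs_abs]
    exact (habs hz (hκ z)).trans (by rw [hR]; linarith)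
  have hbB (κ : ℝ × ℝ → ℝ) (hκ : ∀ z, |κ z| ≤ B) :
      ∀ᵐ z ∂μ, |kruzkovFlux f (u z) (κ z)| ≤ R := by
    filter_upwards [huB] with z hz
    have := mul_le_mul_of_nonneg_left (habs hz (hκ z)) hL0
    exact (abs_kruzkovFlux_le hL hz (hκ z)).trans (by rw [hR]; linarith)
  have hmB (κ : ℝ × ℝ → ℝ) (hκ : Measurable κ) :
      AEStronglyMeasurable (fun z => kruzkovFlux f (u z) (κ z)) μ := by
    refine Measurable.aestronglyMeasurable ?_
    unfold kruzkovFlux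
    exact (hfc.measurable.comp (hum.max hκ)).sub (hfc.measurable.comp (hum.min hκ))
  have hkm : Measurable fun z : ℝ × ℝ => k z.2 := by fun_prop
  have hJ : Integrable (fun z => dt φ z * |u z - k z.2| +
      dx φ z * kruzkovFlux f (u z) (k z.2) + φ z * G (u z) z.2) μ := by
    refine integrable_pairing hφ (R := R) (Measurable.aestronglyMeasurable (by fun_prop))
      (hmB _ hkm) ?_ (hbA _ fun z => hkB z.2) (hbB _ fun z => hkB z.2) ?_
    · exact (hG.measurable.comp (hum.prodMk measurable_snd)).aestronglyMeasurable
    · exact Eventually.of_forall fun z => (hGb _ _).trans (by rw [hR]; linarith)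
  set S : ℝ × ℝ → ℝ := fun z => |dt φ z| + |dx φ z| + |φ z| with hS
  have hSi : Integrable S μ :=
    ((hφ.integrable_dt μ).abs.add (hφ.integrable_dx μ).abs).add (hφ.integrable μ).abs
  have hIi (c : ℝ) (hc : |c| ≤ B) : Integrable fun x => φ (x, 0) * |u₀ x - c| := by
    refine hφ.integrable_initial.mul_bdd (c := 2 * B)
      (Measurable.aestronglyMeasurable (by fun_prop)) ?_
    filter_upwards [hu₀] with x hx
    rw [Real.norm_eq_abs, abs_abs]
    exact habs (hx.trans hMB) hc
  -- the support of `φ`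
  obtain ⟨T₀, hT₀⟩ := (hφ.2.isCompact.image continuous_snd).bddAbove
  set T := max T₀ 0
  have hsupp (z : ℝ × ℝ) (hz : z ∈ tsupport φ) : z.2 ≤ T :=
    (hT₀ (mem_image_of_mem _ hz)).trans (le_max_left _ _)
  have hT0 : 0 ≤ T := le_max_right _ _
  refine ⟨hJ, hIi _ (hkB 0), ?_⟩
  -- testing with the time weights
  suffices hτ : ∀ τ : ℝ, 0 < τ → 0 ≤ (∫ z in spaceTime, (dt φ z * |u z - k z.2| +
      dx φ z * kruzkovFlux f (u z) (k z.2) + φ z * G (u z) z.2)) +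
      (∫ x, φ (x, 0) * |u₀ x - k 0|) +
      τ * ((4 * L + 2) * Λ * (∫ z, S z ∂μ) + 2 * Λ * ∫ x, φ (x, 0)) by
    refine ge_of_tendsto (x := 𝓝[>] (0 : ℝ)) (f := fun τ => _ + τ * _) ?_
      (eventually_mem_nhdsWithin.mono hτ)
    refine Tendsto.mono_left ?_ nhdsWithin_le_nhds
    have : Continuous fun τ : ℝ => (∫ z in spaceTime, (dt φ z * |u z - k z.2| +
      dx φ z * kruzkovFlux f (u z) (k z.2) + φ z * G (u z) z.2)) +
      (∫ x, φ (x, 0) * |u₀ x - k 0|) +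
      τ * ((4 * L + 2) * Λ * (∫ z, S z ∂μ) + 2 * Λ * ∫ x, φ (x, 0)) := by fun_prop
    simpa using this.tendsto 0
  intro τ hτ
  obtain ⟨N, hN⟩ := exists_nat_ge (T / τ + 2)
  have hNs {s : ℝ} (hs : s ≤ T) : s / τ + 2 ≤ N := hN.trans' (by gcongr)
  set ψ : ℕ → ℝ × ℝ → ℝ := fun n z => φ z * timeWeight τ n z.2
  have hwc (n : ℕ) : ContDiff ℝ 1 fun z : ℝ × ℝ => timeWeight τ n z.2 :=
    (contDiff_timeWeight τ n).comp contDiff_snd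
  have hψ (n : ℕ) : IsTestFunction (ψ n) := hφ.mul_right (hwc n)
  have hdt (n : ℕ) (z) :
      dt (ψ n) z = dt φ z * timeWeight τ n z.2 + φ z * timeWeightDeriv τ n z.2 := by
    rw [dt_mul hφ.1 (hwc n), dt_comp_snd (hasDerivAt_timeWeight τ n z.2)]
  have hdx (n : ℕ) (z) : dx (ψ n) z = dx φ z * timeWeight τ n z.2 := by
    rw [dx_mul hφ.1 (hwc n), dx_comp_snd (hasDerivAt_timeWeight τ n z.2), mul_zero, add_zero]
  -- On each time slab the constant is frozen at `k (n τ)`. The derivatives of the weights then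
  -- recover the time variation of `|c - k|`, up to an error of order `τ`.
  have hent (n : ℕ) := hu.2 _ _ (isEntropyPair_abs_sub hf (k (n * τ))) (ψ n) (hψ n)
    fun z hz => mul_nonneg (hφ0 z hz) (timeWeight_nonneg _ _ _)
  have hint (n : ℕ) : Integrable (fun z => dt (ψ n) z * |u z - k (n * τ)| +
      dx (ψ n) z * kruzkovFlux f (u z) (k (n * τ))) μ := by
    have := integrable_pairing (hψ n) (R := R) (μ := μ) (A := fun z => |u z - k (n * τ)|)
      (B := fun z => kruzkovFlux f (u z) (k (n * τ))) (C := fun _ => 0)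
      (Measurable.aestronglyMeasurable (by fun_prop))
      (hmB _ measurable_const) aestronglyMeasurable_const (hbA _ fun z => hkB (n * τ))
      (hbB _ fun z => hkB (n * τ)) (Eventually.of_forall fun z => by simp; rw [hR]; linarith)
    simpa using this
  have htot := Finset.sum_nonneg fun n (_ : n ∈ Finset.range N) => hent n
  rw [Finset.sum_add_distrib, ← integral_finsetSum _ fun n _ => hint n,
    ← integral_finsetSum] at htot
  swap
  · intro n _
    have := (hIi (k (n * τ)) (hkB _)).mul_const (timeWeight τ n 0)
    refine this.congr (Eventually.of_forall fun x => ?_)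
    simp only [ψ]; ring
  have hphi0 (x : ℝ) : 0 ≤ φ (x, 0) := hφ0 _ ⟨mem_univ _, self_mem_Ici⟩
  have hinit : ∫ x, ∑ n ∈ Finset.range N, ψ n (x, 0) * |u₀ x - k (n * τ)| ≤
      (∫ x, φ (x, 0) * |u₀ x - k 0|) + τ * (2 * Λ * ∫ x, φ (x, 0)) := by
    rw [← integral_const_mul, ← integral_const_mul,
      ← integral_add (hIi _ (hkB 0)) ((hφ.integrable_initial.const_mul _).const_mul _)]
    refine integral_mono_of_nonneg (Eventually.of_forall fun x => ?_)
      ((hIi _ (hkB 0)).add ((hφ.integrable_initial.const_mul _).const_mul _))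
      (Eventually.of_forall fun x => ?_)
    · exact Finset.sum_nonneg fun n _ =>
        mul_nonneg (mul_nonneg (hphi0 x) (timeWeight_nonneg _ _ _)) (abs_nonneg _)
    · have hsum := sum_timeWeight hτ le_rfl (hNs hT0)
      calc ∑ n ∈ Finset.range N, ψ n (x, 0) * |u₀ x - k (n * τ)|
          ≤ ∑ n ∈ Finset.range N, timeWeight τ n 0 * (φ (x, 0) * (|u₀ x - k 0| + 2 * Λ * τ)) := by
            refine Finset.sum_le_sum fun n _ => ?_
            by_cases hn : timeWeight τ n 0 = 0
            · simp [ψ, hn]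
            have h1 := hk 0 (n * τ) le_rfl (by positivity)
            have h2 := mul_le_mul_of_nonneg_left (abs_sub_le_of_timeWeight_ne_zero hτ hn) hΛ
            have h3 : |u₀ x - k (n * τ)| ≤ |u₀ x - k 0| + |k (n * τ) - k 0| := by
              rw [abs_sub_comm (k (n * τ))]
              exact abs_sub_le _ _ _
            have h4 := mul_le_mul_of_nonneg_left (show |u₀ x - k (n * τ)| ≤
              |u₀ x - k 0| + 2 * Λ * τ by linarith)
              (mul_nonneg (hphi0 x) (timeWeight_nonneg τ n 0))
            simp only [ψ]
            linarith
        _ = _ := by rw [← Finset.sum_mul, hsum]; ring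
  have hbulk : ∫ z in spaceTime, ∑ n ∈ Finset.range N, (dt (ψ n) z * |u z - k (n * τ)| +
        dx (ψ n) z * kruzkovFlux f (u z) (k (n * τ))) ≤
      (∫ z in spaceTime, (dt φ z * |u z - k z.2| + dx φ z * kruzkovFlux f (u z) (k z.2) +
        φ z * G (u z) z.2)) + τ * ((4 * L + 2) * Λ * ∫ z, S z ∂μ) := by
    rw [← integral_const_mul, ← integral_const_mul,
      ← integral_add hJ ((hSi.const_mul _).const_mul _)]
    refine integral_mono_ae (integrable_finsetSum _ fun n _ => hint n)
      (hJ.add ((hSi.const_mul _).const_mul _)) ?_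
    filter_upwards [huB, ae_restrict_mem measurableSet_spaceTime] with z hz hzs
    have hs : 0 ≤ z.2 := hzs.2
    simp only [hdt, hdx]
    by_cases hzφ : z ∈ tsupport φ
    · have := sum_timeWeight_pairing_le hL0 hL hΛ hk hkB hz (g := G (u z)) hs
        (hG.comp (by fun_prop : Continuous fun t : ℝ => (u z, t)))
        (fun r hr => hGl _ _ _ hs hr) (hGk (u z)) hτ (hNs (hsupp z hzφ))
        (φ z) (dt φ z) (dx φ z) (hφ0 z hzs)
      simpa only [hS, abs_of_nonneg (hφ0 z hzs)] using this
    · simp [hS, dt_eq_zero hzφ, dx_eq_zero hzφ, image_eq_zero_of_notMem_tsupport hzφ]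
  refine htot.trans ((add_le_add hbulk hinit).trans_eq ?_)
  ring

/-! ### A partition of unity in space, adapted to the cells -/

/-- The mollified indicator of the cell `[i h, (i + 1) h)`, at the scale `ε`. -/
def cellWeight (h ε : ℝ) (i : ℤ) (y : ℝ) : ℝ :=
  smoothStep (((i + 1) * h - y) / ε) - smoothStep ((i * h - y) / ε)

/-- The mollifier at the scale `ε`, centred at the node `i h`. -/
def nodeWeight (h ε : ℝ) (i : ℤ) (y : ℝ) : ℝ := hat ((i * h - y) / ε) / ε

/-- The interval where the weights of the `i`-th cell live. -/
def weightSupport (h ε : ℝ) (i : ℤ) : Set ℝ := Icc (i * h - 2 * ε) ((i + 1) * h)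

section Weights

variable {h ε : ℝ}

lemma hasDerivAt_cellWeight (h ε : ℝ) (i : ℤ) (y : ℝ) :
    HasDerivAt (cellWeight h ε i) (-(nodeWeight h ε (i + 1) y - nodeWeight h ε i y)) y := by
  have hd (c : ℝ) : HasDerivAt (fun y => smoothStep ((c - y) / ε))
      (hat ((c - y) / ε) * (-1 / ε)) y :=
    (hasDerivAt_smoothStep _).comp y (((hasDerivAt_id y).const_sub c).div_const ε)
  refine ((hd ((i + 1) * h)).sub (hd (i * h))).congr_deriv ?_
  unfold nodeWeight
  push_cast
  ring

lemma contDiff_cellWeight (h ε : ℝ) (i : ℤ) : ContDiff ℝ 1 (cellWeight h ε i) := by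
  unfold cellWeight
  exact (contDiff_smoothStep.comp (by fun_prop)).sub (contDiff_smoothStep.comp (by fun_prop))

lemma cellWeight_nonneg (hh : 0 ≤ h) (hε : 0 < ε) (i : ℤ) (y : ℝ) : 0 ≤ cellWeight h ε i y :=
  sub_nonneg.2 (smoothStep_monotone (by gcongr; linarith))

lemma cellWeight_eq_zero (hε : 0 < ε) (hh : 0 ≤ h) {i : ℤ} {y : ℝ}
    (hy : (i + 1) * h ≤ y ∨ y + 2 * ε ≤ i * h) : cellWeight h ε i y = 0 := by
  rcases hy with hy | hy
  · rw [cellWeight, smoothStep_of_nonpos (div_nonpos_of_nonpos_of_nonneg (by linarith) hε.le),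
      smoothStep_of_nonpos (div_nonpos_of_nonpos_of_nonneg (by linarith) hε.le), sub_zero]
  · rw [cellWeight, smoothStep_of_two_le ((le_div_iff₀ hε).2 (by linarith)),
      smoothStep_of_two_le ((le_div_iff₀ hε).2 (by linarith)), sub_self]

lemma nodeWeight_eq_zero (hε : 0 < ε) {i : ℤ} {y : ℝ}
    (hy : i * h ≤ y ∨ y + 2 * ε ≤ i * h) : nodeWeight h ε i y = 0 := by
  rcases hy with hy | hy
  · rw [nodeWeight, hat_of_nonpos (div_nonpos_of_nonpos_of_nonneg (by linarith) hε.le), zero_div]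
  · rw [nodeWeight, hat_of_two_le ((le_div_iff₀ hε).2 (by linarith)), zero_div]

lemma sum_cellWeight (hε : 0 < ε) {a b : ℤ} (hab : a ≤ b) {y : ℝ} (ha : a * h ≤ y)
    (hb : y + 2 * ε ≤ b * h) : ∑ i ∈ Finset.Ico a b, cellWeight h ε i y = 1 := by
  have := sum_Ico_int_sub (fun i : ℤ => smoothStep ((i * h - y) / ε)) hab
  rw [smoothStep_of_two_le ((le_div_iff₀ hε).2 (by linarith)),
    smoothStep_of_nonpos (x := (a * h - y) / ε)
      (div_nonpos_of_nonpos_of_nonneg (by linarith) hε.le), sub_zero] at this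
  rw [← this]
  simp [cellWeight]

/-- Adjacent nodes are `h / ε = ε` apart in the rescaled variable and `hat` is 1-Lipschitz, so with
the factor `1 / ε` the difference is at most `h / ε² = 1`. -/
lemma abs_nodeWeight_sub_le (hε : 0 < ε) (hh : ε ^ 2 = h) (i : ℤ) (y : ℝ) :
    |nodeWeight h ε (i + 1) y - nodeWeight h ε i y| ≤ (weightSupport h ε i).indicator 1 y := by
  have hh0 : 0 < h := hh ▸ by positivity
  by_cases hy : y ∈ weightSupport h ε i
  · rw [indicator_of_mem hy, nodeWeight, nodeWeight, ← sub_div, abs_div, abs_of_pos hε,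
      Pi.one_apply, div_le_one hε]
    refine (abs_hat_sub_le _ _).trans_eq ?_
    rw [← sub_div, show ((i + 1 : ℤ) * h - y - (i * h - y)) / ε = ε by
      push_cast; rw [← hh]; field_simp; ring, abs_of_pos hε]
  · rw [indicator_of_notMem hy]
    rw [weightSupport, mem_Icc, not_and_or, not_le, not_le] at hy
    rw [nodeWeight_eq_zero hε (by push_cast; rcases hy with h1 | h1 <;> [right; left] <;> linarith),
      nodeWeight_eq_zero hε (by rcases hy with h1 | h1 <;> [right; left] <;> linarith)]
    simp

/-- Mean value theorem, with a 1-Lipschitz derivative. -/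
lemma abs_smoothStep_sub_le (x : ℝ) {δ : ℝ} (hδ : 0 < δ) :
    |smoothStep (x + δ) - smoothStep x - δ * hat x| ≤ δ ^ 2 := by
  obtain ⟨ξ, hξ, he⟩ := exists_hasDerivAt_eq_slope smoothStep hat (show x < x + δ by linarith)
    continuous_smoothStep.continuousOn fun y _ => hasDerivAt_smoothStep y
  rw [add_sub_cancel_left, eq_div_iff hδ.ne'] at he
  rw [← he, mul_comm, ← mul_sub, abs_mul, abs_of_pos hδ, sq]
  gcongr
  refine (abs_hat_sub_le _ _).trans ?_
  rw [abs_le]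
  constructor <;> linarith [hξ.1, hξ.2]

/-- `cellWeight` is an increment of `smoothStep` over a rescaled step `ε`, so the Taylor remainder
is at most `ε²`, which is exactly the divisor `h`. -/
lemma abs_cellWeight_div_sub_le (hε : 0 < ε) (hh : ε ^ 2 = h) (i : ℤ) (y : ℝ) :
    |cellWeight h ε i y / h - nodeWeight h ε i y| ≤ (weightSupport h ε i).indicator 1 y := by
  have hh0 : 0 < h := hh ▸ by positivity
  by_cases hy : y ∈ weightSupport h ε i
  · rw [indicator_of_mem hy, Pi.one_apply]
    have h1 := abs_smoothStep_sub_le ((i * h - y) / ε) hε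
    have h2 : (i * h - y) / ε + ε = ((i + 1) * h - y) / ε := by
      rw [← hh]; field_simp; ring
    rw [h2] at h1
    have h3 : cellWeight h ε i y / h - nodeWeight h ε i y =
        (smoothStep (((i + 1) * h - y) / ε) - smoothStep ((i * h - y) / ε) -
          ε * hat ((i * h - y) / ε)) / ε ^ 2 := by
      rw [cellWeight, nodeWeight, hh, sub_div, sub_div _ (ε * _), ← hh]
      field_simp
    rw [h3, abs_div, abs_of_pos (by positivity : 0 < ε ^ 2), div_le_one (by positivity)]
    exact h1
  · rw [indicator_of_notMem hy]
    rw [weightSupport, mem_Icc, not_and_or, not_le, not_le] at hy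
    rw [nodeWeight_eq_zero hε (by rcases hy with h1 | h1 <;> [right; left] <;> linarith),
      cellWeight_eq_zero hε hh0.le (by rcases hy with h1 | h1 <;> [right; left] <;> linarith)]
    simp

lemma integral_indicator_weightSupport (hh : 0 ≤ h) (hε : 0 ≤ ε) (i : ℤ) :
    ∫ y, (weightSupport h ε i).indicator (1 : ℝ → ℝ) y = 2 * ε + h := by
  rw [weightSupport, integral_indicator_one measurableSet_Icc, Measure.real, Real.volume_Icc,
    ENNReal.toReal_ofReal (by linarith)]
  ring

lemma integrable_indicator_weightSupport (h ε : ℝ) (i : ℤ) :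
    Integrable ((weightSupport h ε i).indicator (1 : ℝ → ℝ)) :=
  (integrable_indicator_iff measurableSet_Icc).2
    (integrableOn_const (by simp) (by simp))

end Weights

/-! ### Consistency of the numerical entropy fluxes -/

/-- The variation of grid values over the stencils of the two interfaces of the `i`-th cell. -/
def stencilVariation (p : ℕ) (v : ℤ → ℝ) (i : ℤ) : ℝ :=
  ∑ j ∈ Finset.Ico (i - p) (i + p), |v (j + 1) - v j|

/-- The projection of `ℝ` onto `[-M, M]`. -/
def clip (M c : ℝ) : ℝ := max (-M) (min M c)

lemma abs_sub_le_sum (v : ℤ → ℝ) {a b : ℤ} (hab : a ≤ b) :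
    |v b - v a| ≤ ∑ j ∈ Finset.Ico a b, |v (j + 1) - v j| := by
  rw [← sum_Ico_int_sub v hab]
  exact Finset.abs_sum_le_sum_abs _ _

lemma stencilVariation_nonneg (p : ℕ) (v : ℤ → ℝ) (i : ℤ) : 0 ≤ stencilVariation p v i :=
  Finset.sum_nonneg fun _ _ => abs_nonneg _

lemma abs_sub_le_stencilVariation (p : ℕ) (v : ℤ → ℝ) {i j : ℤ} (h1 : i - p ≤ j) (h2 : j ≤ i + p) :
    |v j - v i| ≤ stencilVariation p v i := by
  have hmono (a b : ℤ) (ha : i - p ≤ a) (hb : b ≤ i + p) :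
      ∑ j ∈ Finset.Ico a b, |v (j + 1) - v j| ≤ stencilVariation p v i :=
    Finset.sum_le_sum_of_subset_of_nonneg (Finset.Ico_subset_Ico ha hb)
      fun _ _ _ => abs_nonneg _
  rcases le_total i j with hij | hij
  · exact (abs_sub_le_sum v hij).trans (hmono _ _ (by lia) h2)
  · rw [abs_sub_comm]
    exact (abs_sub_le_sum v hij).trans (hmono _ _ h1 (by lia))

/-- After exchanging the sums, each of the `2p` positions in the stencil contributes one translate
of the sum of jumps. -/
lemma sum_stencilVariation_le (p : ℕ) {v : ℤ → ℝ} {W : ℝ}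
    (hW : ∀ s : Finset ℤ, ∑ i ∈ s, |v (i + 1) - v i| ≤ W) (s : Finset ℤ) :
    ∑ i ∈ s, stencilVariation p v i ≤ 2 * p * W := by
  have he (i : ℤ) : stencilVariation p v i =
      ∑ k ∈ Finset.range (2 * p), |v (i - p + k + 1) - v (i - p + k)| := by
    rw [← sum_Ico_int (fun j => |v (j + 1) - v j|), stencilVariation]
    congr 2
    push_cast; ring
  simp only [he]
  rw [Finset.sum_comm]
  calc _ ≤ ∑ k ∈ Finset.range (2 * p), W := by
        refine Finset.sum_le_sum fun k _ => ?_
        have := hW (s.map (addRightEmbedding (-p + k)))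
        rw [Finset.sum_map] at this
        simpa [← add_assoc, ← sub_eq_add_neg] using this
    _ = 2 * p * W := by simp

section Consistency

variable {f : ℝ → ℝ} {M L : ℝ} {p : ℕ} {F : (Fin (2 * p) → ℝ) → ℝ}

lemma abs_clip_le (hM : 0 ≤ M) (c : ℝ) : |clip M c| ≤ M := by unfold clip; grind

@[fun_prop]
lemma continuous_clip (M : ℝ) : Continuous (clip M) := by unfold clip; fun_prop

/-- The projection of `c` lies between `x` and `c`. The part that depends on `x` thus involves only
a constant in `[-M, M]`, where the scheme is monotone. -/
lemma abs_sub_eq_clip {c x : ℝ} (hx : |x| ≤ M) : |c - x| = |x - clip M c| + |c - clip M c| := by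
  unfold clip; grind

/-- The companion splitting of the entropy flux; its last term does not depend on `x` and is removed
by telescoping over the cells. -/
lemma kruzkovFlux_eq_clip {c x : ℝ} (hx : |x| ≤ M) :
    kruzkovFlux f c x = kruzkovFlux f (clip M c) x + kruzkovFlux f c (clip M c) := by
  rw [abs_le] at hx
  rcases le_total c (-M) with h1 | h1
  · rw [clip, min_eq_right (by linarith), max_eq_left h1]
    simp only [kruzkovFlux, max_eq_right hx.1, max_eq_right h1, max_eq_right (h1.trans hx.1),
      min_eq_left hx.1, min_eq_left h1, min_eq_left (h1.trans hx.1)]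
    ring
  rcases le_total c M with h2 | h2
  · rw [clip, min_eq_right h2, max_eq_right h1]
    simp [kruzkovFlux]
  · rw [clip, min_eq_left h2, max_eq_right (by linarith)]
    simp only [kruzkovFlux, max_eq_left hx.2, max_eq_left h2, max_eq_left (hx.2.trans h2),
      min_eq_right hx.2, min_eq_right h2, min_eq_right (hx.2.trans h2)]
    ring

lemma fluxGap_const (hF : IsMonotoneFlux f M F) (c x : ℝ) (m : ℤ) :
    fluxGap F (fun _ => x) (fun _ => c) m = kruzkovFlux f c x := by
  rw [fluxGap, interfaceFlux_const hF, interfaceFlux_const hF, kruzkovFlux, max_comm, min_comm]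

lemma IsFluxLipschitz.abs_fluxGap_sub_le (hL : IsFluxLipschitz F M L) {v w : ℤ → ℝ} {c : ℝ}
    {m : ℤ} {σ : ℝ} (hv : ∀ j, |v j| ≤ M) (hw : ∀ j, |w j| ≤ M) (hc : |c| ≤ M) (hσ : 0 ≤ σ)
    (hvw : ∀ j, m - p + 1 ≤ j → j ≤ m + p → |v j - w j| ≤ σ) :
    |fluxGap F v (fun _ => c) m - fluxGap F w (fun _ => c) m| ≤ 2 * L * σ := by
  have h1 := hL.2 (fun j => max (v j) c) (fun j => max (w j) c) m σ
    (fun j => abs_max_le_of (hv j) hc) (fun j => abs_max_le_of (hw j) hc) hσ fun j hj1 hj2 =>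
      (abs_max_sub_max_le_abs _ _ _).trans (hvw j hj1 hj2)
  have h2 := hL.2 (fun j => min (v j) c) (fun j => min (w j) c) m σ
    (fun j => abs_min_le_of (hv j) hc) (fun j => abs_min_le_of (hw j) hc) hσ fun j hj1 hj2 => by
      refine (abs_min_sub_min_le_max _ _ _ _).trans ?_
      simpa [hσ] using hvw j hj1 hj2
  unfold fluxGap
  rw [sub_sub_sub_comm]
  refine (abs_sub _ _).trans ?_
  linarith

/-- Pointwise consistency of the space discretization. The sum is the weak form of the difference
between the entropy flux and the numerical entropy flux, tested with the cell weights. -/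
lemma sum_flux_consistency_le (hF : IsMonotoneFlux f M F) (hM : 0 ≤ M)
    (hL : IsFluxLipschitz F M L) {h ε : ℝ} (hε : 0 < ε) (hh : ε ^ 2 = h) {v : ℤ → ℝ}
    (hv : ∀ j, |v j| ≤ M) (c : ℝ) {a b : ℤ} (hab : a ≤ b) {y : ℝ} (ha : a * h ≤ y)
    (hb : y + 2 * ε ≤ b * h) :
    ∑ i ∈ Finset.Ico a b,
      (-(nodeWeight h ε (i + 1) y - nodeWeight h ε i y) * kruzkovFlux f c (v i) +
        cellWeight h ε i y * ((fluxGap F v (fun _ => clip M c) (i - 1) -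
          fluxGap F v (fun _ => clip M c) i) / h)) ≤
    ∑ i ∈ Finset.Ico a b,
      6 * L * stencilVariation p v i * (weightSupport h ε i).indicator 1 y := by
  set Q : ℤ → ℝ := fun i => fluxGap F v (fun _ => clip M c) i with hQ
  set c' := clip M c
  have hc' : |c'| ≤ M := abs_clip_le hM c
  set ν : ℤ → ℝ := fun i => nodeWeight h ε i y with hν
  have hνa : ν a = 0 := nodeWeight_eq_zero hε (Or.inl ha)
  have hνb : ν b = 0 := nodeWeight_eq_zero hε (Or.inr hb)
  -- This telescoping sum vanishes because the node weights at both ends do. Adding it subtracts the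
  -- numerical flux `Q` from the exact one and absorbs the contribution of `c` outside `[-M, M]`.
  have htel := sum_Ico_int_sub (fun i => ν i * (Q (i - 1) + kruzkovFlux f c c')) hab
  simp only [hνa, hνb, zero_mul, sub_zero, add_sub_cancel_right] at htel
  rw [← add_zero (∑ i ∈ Finset.Ico a b, (_ + _)), ← htel, ← Finset.sum_add_distrib]
  refine Finset.sum_le_sum fun i _ => ?_
  have hq (m : ℤ) (h1 : i - 1 ≤ m) (h2 : m ≤ i) :
      |Q m - kruzkovFlux f c' (v i)| ≤ 2 * L * stencilVariation p v i := by
    rw [← fluxGap_const hF c' (v i) m]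
    exact hL.abs_fluxGap_sub_le hv (fun _ => hv i) hc' (stencilVariation_nonneg p v i)
      fun j hj1 hj2 => abs_sub_le_stencilVariation p v (by lia) (by lia)
  have hq1 := hq i (by lia) le_rfl
  have hq2 := hq (i - 1) le_rfl (by lia)
  have hq3 : |Q (i - 1) - Q i| ≤ 4 * L * stencilVariation p v i := by
    refine (abs_sub_le _ (kruzkovFlux f c' (v i)) _).trans ?_
    rw [abs_sub_comm _ (Q i)]
    linarith
  have hw1 := abs_nodeWeight_sub_le hε hh i y
  have hw2 := abs_cellWeight_div_sub_le hε hh i y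
  have hm1 := mul_le_mul hw1 hq1 (abs_nonneg _) ((abs_nonneg _).trans hw1)
  have hm2 := mul_le_mul hw2 hq3 (abs_nonneg _) ((abs_nonneg _).trans hw2)
  rw [← abs_mul] at hm1 hm2
  -- Each term becomes a weight error, at most `1` on `weightSupport`, times a flux error bounded by
  -- the stencil variation.
  have e : -(nodeWeight h ε (i + 1) y - nodeWeight h ε i y) * kruzkovFlux f c (v i) +
      cellWeight h ε i y * ((Q (i - 1) - Q i) / h) +
      (ν (i + 1) * (Q i + kruzkovFlux f c c') - ν i * (Q (i - 1) + kruzkovFlux f c c')) =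
      (nodeWeight h ε (i + 1) y - nodeWeight h ε i y) * (Q i - kruzkovFlux f c' (v i)) +
        (cellWeight h ε i y / h - nodeWeight h ε i y) * (Q (i - 1) - Q i) := by
    rw [kruzkovFlux_eq_clip (hv i)]
    simp only [hν, c']
    ring
  rw [e]
  linarith [le_of_abs_le hm1, le_of_abs_le hm2]

/-- Pointwise bound for the mollification of a cell function, by its jumps nearby. -/
lemma sum_cellWeight_mul_abs_sub_le {h ε : ℝ} (hε : 0 < ε) (hh : 0 < h) (v : ℤ → ℝ) {a b : ℤ}
    (hab : a ≤ b) {y : ℝ} (ha : a * h ≤ y) (hb : y + 2 * ε ≤ b * h) :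
    ∑ i ∈ Finset.Ico a b, cellWeight h ε i y * |cellFunction h v y - v i| ≤
      ∑ i ∈ Finset.Ico a b, |v (i + 1) - v i| * (weightSupport h ε i).indicator 1 y := by
  set X := ∑ i ∈ Finset.Ico a b, |v (i + 1) - v i| * (weightSupport h ε i).indicator 1 y with hX
  have hterm (j : ℤ) : 0 ≤ |v (j + 1) - v j| * (weightSupport h ε j).indicator 1 y :=
    mul_nonneg (abs_nonneg _) (indicator_nonneg (fun _ _ => zero_le_one) _)
  calc _ ≤ ∑ i ∈ Finset.Ico a b, cellWeight h ε i y * X := by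
        refine Finset.sum_le_sum fun i hi => ?_
        by_cases hi0 : cellWeight h ε i y = 0
        · simp [hi0]
        refine mul_le_mul_of_nonneg_left ?_ (cellWeight_nonneg hh.le hε i y)
        have h1 : y < (i + 1) * h := by
          by_contra! h1; exact hi0 (cellWeight_eq_zero hε hh.le (Or.inl h1))
        have h2 : i * h < y + 2 * ε := by
          by_contra! h2; exact hi0 (cellWeight_eq_zero hε hh.le (Or.inr h2))
        -- The mollifier is one-sided: cells with nonzero weight at `y` lie at or to the right of
        -- the cell of `y`, and the jumps in between all have `y` in their `weightSupport`.
        have hm1 : ⌊y / h⌋ ≤ i := by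
          rw [← Int.lt_add_one_iff, Int.floor_lt, div_lt_iff₀ hh]; exact_mod_cast h1
        have hm2 : a ≤ ⌊y / h⌋ := by rwa [Int.le_floor, le_div_iff₀ hh]
        rw [abs_sub_comm]
        refine (abs_sub_le_sum v hm1).trans ?_
        rw [Finset.mem_Ico] at hi
        refine le_trans (Finset.sum_le_sum fun j hj => ?_)
          (Finset.sum_le_sum_of_subset_of_nonneg (Finset.Ico_subset_Ico hm2 hi.2.le)
            fun j _ _ => hterm j)
        rw [Finset.mem_Ico] at hj
        rw [indicator_of_mem, Pi.one_apply, mul_one]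
        have hj1 : ((j : ℝ) + 1) ≤ i := by exact_mod_cast hj.2
        have hj2 : y < (j + 1) * h := by
          rw [← div_lt_iff₀ hh]
          refine (Int.lt_floor_add_one _).trans_le ?_
          gcongr
          exact_mod_cast hj.1
        have hj3 := mul_le_mul_of_nonneg_right hj1 hh.le
        exact ⟨by linarith, hj2.le⟩
    _ = X := by rw [← Finset.sum_mul, sum_cellWeight hε hab ha hb, one_mul]

end Consistency

/-! ### A decaying cutoff on backward cones -/

/-- A cutoff supported, for nonnegative times, in a backward cone with speed `ℓ` over `[-R, R]`,
which decays like `exp (-t)`. -/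
def coneCutoff (ℓ R : ℝ) (z : ℝ × ℝ) : ℝ :=
  Real.exp (-z.2) * (smoothStep (R - ℓ * z.2 - z.1) * smoothStep (R - ℓ * z.2 + z.1)) *
    smoothStep (z.2 + 2)

section Cutoff

variable {ℓ R : ℝ} {z : ℝ × ℝ}

lemma contDiff_coneCutoff (ℓ R : ℝ) : ContDiff ℝ 1 (coneCutoff ℓ R) := by
  have h1 : ContDiff ℝ 1 fun z : ℝ × ℝ => smoothStep (R - ℓ * z.2 - z.1) :=
    contDiff_smoothStep.comp (by fun_prop)
  have h2 : ContDiff ℝ 1 fun z : ℝ × ℝ => smoothStep (R - ℓ * z.2 + z.1) :=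
    contDiff_smoothStep.comp (by fun_prop)
  have h3 : ContDiff ℝ 1 fun z : ℝ × ℝ => smoothStep (z.2 + 2) :=
    contDiff_smoothStep.comp (by fun_prop)
  have h4 : ContDiff ℝ 1 fun z : ℝ × ℝ => Real.exp (-z.2) := by fun_prop
  exact (h4.mul (h1.mul h2)).mul h3

lemma coneCutoff_nonneg (ℓ R : ℝ) (z : ℝ × ℝ) : 0 ≤ coneCutoff ℓ R z :=
  mul_nonneg (mul_nonneg (Real.exp_pos _).le (mul_nonneg (smoothStep_nonneg _)
    (smoothStep_nonneg _))) (smoothStep_nonneg _)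

lemma coneCutoff_le (ℓ R : ℝ) (z : ℝ × ℝ) : coneCutoff ℓ R z ≤ Real.exp (-z.2) := by
  have h1 := mul_le_one₀ (smoothStep_le_one (R - ℓ * z.2 - z.1)) (smoothStep_nonneg _)
    (smoothStep_le_one (R - ℓ * z.2 + z.1))
  unfold coneCutoff
  rw [mul_assoc]
  exact mul_le_of_le_one_right (Real.exp_pos _).le
    (mul_le_one₀ h1 (smoothStep_nonneg _) (smoothStep_le_one _))

lemma abs_lt_of_coneCutoff_ne_zero (h : coneCutoff ℓ R z ≠ 0) :
    |z.1| < R - ℓ * z.2 ∧ -2 < z.2 := by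
  have h1 : 0 < R - ℓ * z.2 - z.1 := by
    by_contra! h1; exact h (by simp [coneCutoff, smoothStep_of_nonpos h1])
  have h2 : 0 < R - ℓ * z.2 + z.1 := by
    by_contra! h1; exact h (by simp [coneCutoff, smoothStep_of_nonpos h1])
  have h3 : 0 < z.2 + 2 := by
    by_contra! h1; exact h (by simp [coneCutoff, smoothStep_of_nonpos h1])
  exact ⟨abs_lt.2 ⟨by linarith, by linarith⟩, by linarith⟩

/-- The factor `smoothStep (z.2 + 2)` serves to bound the support for negative times; it equals `1`
for `t ≥ 0`. The positive speed closes the cone from above. -/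
lemma isTestFunction_coneCutoff (hℓ : 0 < ℓ) (R : ℝ) : IsTestFunction (coneCutoff ℓ R) := by
  refine ⟨contDiff_coneCutoff ℓ R, HasCompactSupport.intro
    ((isCompact_Icc (a := -(R + 2 * ℓ)) (b := R + 2 * ℓ)).prod
      (isCompact_Icc (a := -2) (b := R / ℓ))) fun z hz => ?_⟩
  by_contra h
  obtain ⟨h1, h2⟩ := abs_lt_of_coneCutoff_ne_zero h
  have h3 : 0 < R - ℓ * z.2 := (abs_nonneg _).trans_lt h1
  have h4 : z.2 ≤ R / ℓ := by rw [le_div_iff₀ hℓ]; linarith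
  have h5 : R - ℓ * z.2 ≤ R + 2 * ℓ := by nlinarith
  have h6 := abs_le.1 (h1.le.trans h5)
  exact hz ⟨⟨h6.1, h6.2⟩, h2.le, h4⟩

lemma coneCutoff_eq (hs : 0 ≤ z.2) (hR : |z.1| + ℓ * z.2 + 2 ≤ R) :
    coneCutoff ℓ R z = Real.exp (-z.2) := by
  have := abs_le.1 (le_refl |z.1|)
  rw [coneCutoff, smoothStep_of_two_le (x := R - _ - _) (by linarith),
    smoothStep_of_two_le (x := R - _ + _) (by linarith),
    smoothStep_of_two_le (x := z.2 + 2) (by linarith)]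
  ring

lemma dt_eq_of_hasDerivAt {φ : ℝ × ℝ → ℝ} (hφ : ContDiff ℝ 1 φ) {φ' : ℝ}
    (h : HasDerivAt (fun s => φ (z.1, s)) φ' z.2) : dt φ z = φ' :=
  ((hφ.differentiable one_ne_zero z).hasFDerivAt.comp_hasDerivAt z.2
    ((hasDerivAt_const z.2 z.1).prodMk (hasDerivAt_id z.2))).unique h

lemma dx_eq_of_hasDerivAt {φ : ℝ × ℝ → ℝ} (hφ : ContDiff ℝ 1 φ) {φ' : ℝ}
    (h : HasDerivAt (fun y => φ (y, z.2)) φ' z.1) : dx φ z = φ' :=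
  ((hφ.differentiable one_ne_zero z).hasFDerivAt.comp_hasDerivAt z.1
    ((hasDerivAt_id z.1).prodMk (hasDerivAt_const z.1 z.2))).unique h

/-- The flanks of the cone recede at speed `ℓ`, so their time derivative compensates `ℓ |∂ₓχ|`;
differentiating the exponential supplies `-χ`. -/
lemma dt_coneCutoff_add_le (hℓ : 0 ≤ ℓ) (R : ℝ) (hs : 0 ≤ z.2) :
    dt (coneCutoff ℓ R) z + ℓ * |dx (coneCutoff ℓ R) z| ≤ -coneCutoff ℓ R z := by
  obtain ⟨y, s⟩ := z
  simp only at hs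
  have hstep {g : ℝ → ℝ} {g' x : ℝ} (hg : HasDerivAt g g' x) :
      HasDerivAt (fun x => smoothStep (g x)) (hat (g x) * g') x :=
    (hasDerivAt_smoothStep (g x)).comp x hg
  have e0 : smoothStep (s + 2) = 1 := smoothStep_of_two_le (by linarith)
  have e0' : hat (s + 2) = 0 := hat_of_two_le (by linarith)
  set A := smoothStep (R - ℓ * s - y) with hA
  set B := smoothStep (R - ℓ * s + y) with hB
  set A' := hat (R - ℓ * s - y) with hA'
  set B' := hat (R - ℓ * s + y) with hB'
  have e1 : dt (coneCutoff ℓ R) (y, s) =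
      -(Real.exp (-s) * (A * B)) + Real.exp (-s) * (-ℓ * (A' * B + A * B')) := by
    refine dt_eq_of_hasDerivAt (contDiff_coneCutoff ℓ R) ?_
    have d1 := hstep ((((hasDerivAt_id s).const_mul ℓ).const_sub R).sub_const y)
    have d2 := hstep ((((hasDerivAt_id s).const_mul ℓ).const_sub R).add_const y)
    have d3 := hstep ((hasDerivAt_id s).add_const 2)
    refine (((hasDerivAt_id s).neg.exp.mul (d1.mul d2)).mul d3).congr_deriv ?_
    simp only [Pi.mul_apply, Pi.neg_apply, id, ← hA, ← hB, ← hA', ← hB', e0, e0']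
    ring
  have e2 : dx (coneCutoff ℓ R) (y, s) = Real.exp (-s) * (-(A' * B) + A * B') := by
    refine dx_eq_of_hasDerivAt (contDiff_coneCutoff ℓ R) ?_
    have d1 := hstep ((hasDerivAt_id y).const_sub (R - ℓ * s))
    have d2 := hstep ((hasDerivAt_id y).const_add (R - ℓ * s))
    refine (((d1.mul d2).const_mul (Real.exp (-s))).mul_const
      (smoothStep (s + 2))).congr_deriv ?_
    simp only [id, ← hA, ← hB, ← hA', ← hB', e0]
    ring
  have hA0 : 0 ≤ A := smoothStep_nonneg _
  have hB0 : 0 ≤ B := smoothStep_nonneg _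
  have hA'0 : 0 ≤ A' := hat_nonneg _
  have hB'0 : 0 ≤ B' := hat_nonneg _
  have e3 : |-(A' * B) + A * B'| ≤ A' * B + A * B' := by
    have := mul_nonneg hA'0 hB0
    have := mul_nonneg hA0 hB'0
    rw [abs_le]; constructor <;> linarith
  have e4 : coneCutoff ℓ R (y, s) = Real.exp (-s) * (A * B) := by
    simp only [coneCutoff, ← hA, ← hB, e0, mul_one]
  rw [e1, e2, e4, abs_mul, abs_of_pos (Real.exp_pos _)]
  have := mul_le_mul_of_nonneg_left e3 (mul_nonneg hℓ (Real.exp_pos (-s)).le)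
  linarith

end Cutoff

/-! ### Comparison of the scheme with the entropy solution -/

section Comparison

variable {f : ℝ → ℝ} {M L : ℝ} {p : ℕ} {F : (Fin (2 * p) → ℝ) → ℝ}

/-- The local contributions to the error of the scheme. -/
def cellError (p : ℕ) (L : ℝ) (v : ℤ → ℝ) (i : ℤ) : ℝ :=
  |v (i + 1) - v i| + 6 * L * stencilVariation p v i

lemma cellError_nonneg (p : ℕ) (hL : 0 ≤ L) (v : ℤ → ℝ) (i : ℤ) : 0 ≤ cellError p L v i := by
  have := stencilVariation_nonneg p v i
  unfold cellError; positivity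

lemma sum_cellError_le (p : ℕ) (hL : 0 ≤ L) {v : ℤ → ℝ} {W : ℝ}
    (hW : ∀ s : Finset ℤ, ∑ i ∈ s, |v (i + 1) - v i| ≤ W) (s : Finset ℤ) :
    ∑ i ∈ s, cellError p L v i ≤ (1 + 12 * L * p) * W := by
  simp only [cellError, Finset.sum_add_distrib, ← Finset.mul_sum]
  have h1 := hW s
  have h2 := mul_le_mul_of_nonneg_left (sum_stencilVariation_le p hW s) hL
  linarith

/-- The heart of the estimate, at a fixed point. The cone condition turns the derivatives of the
cutoff into a damping term, the flux terms are controlled by consistency, and replacing `v i` by the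
value in the cell of `y` costs nearby jumps. -/
lemma sum_pairing_le (hF : IsMonotoneFlux f M F) (hM : 0 ≤ M) (hL : IsFluxLipschitz F M L)
    {h ε : ℝ} (hε : 0 < ε) (hh : ε ^ 2 = h) {v : ℤ → ℝ} (hv : ∀ j, |v j| ≤ M) {c ℓ : ℝ}
    (hq : ∀ i, |kruzkovFlux f c (v i)| ≤ ℓ * |c - v i|) {a b : ℤ} (hab : a ≤ b) {y : ℝ}
    {χ χt χx : ℝ} (hχ : 0 ≤ χ) (hcone : χt + ℓ * |χx| ≤ -χ)
    (hy : χ ≠ 0 → a * h ≤ y ∧ y + 2 * ε ≤ b * h) :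
    ∑ i ∈ Finset.Ico a b, (χt * cellWeight h ε i y * |c - v i| +
      (χx * cellWeight h ε i y + χ * -(nodeWeight h ε (i + 1) y - nodeWeight h ε i y)) *
        kruzkovFlux f c (v i) +
      χ * cellWeight h ε i y * ((fluxGap F v (fun _ => clip M c) (i - 1) -
          fluxGap F v (fun _ => clip M c) i) / h)) ≤
    -(χ * |c - cellFunction h v y|) +
      χ * ∑ i ∈ Finset.Ico a b, cellError p L v i * (weightSupport h ε i).indicator 1 y := by
  have hh0 : 0 < h := hh ▸ by positivity
  set I := Finset.Ico a b
  have h1 : ∑ i ∈ I, cellWeight h ε i y * (χt * |c - v i| + χx * kruzkovFlux f c (v i)) ≤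
      ∑ i ∈ I, -χ * (cellWeight h ε i y * |c - v i|) := by
    refine Finset.sum_le_sum fun i _ => ?_
    have e1 : χx * kruzkovFlux f c (v i) ≤ |χx| * (ℓ * |c - v i|) := by
      refine (le_abs_self _).trans ?_
      rw [abs_mul]
      exact mul_le_mul_of_nonneg_left (hq i) (abs_nonneg _)
    have e2 := mul_le_mul_of_nonneg_right hcone (abs_nonneg (c - v i))
    have e3 : χt * |c - v i| + χx * kruzkovFlux f c (v i) ≤ -χ * |c - v i| := by linarith
    have e4 := mul_le_mul_of_nonneg_left e3 (cellWeight_nonneg hh0.le hε i y)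
    linarith
  have hsplit : ∑ i ∈ I, (χt * cellWeight h ε i y * |c - v i| +
      (χx * cellWeight h ε i y + χ * -(nodeWeight h ε (i + 1) y - nodeWeight h ε i y)) *
        kruzkovFlux f c (v i) +
      χ * cellWeight h ε i y * ((fluxGap F v (fun _ => clip M c) (i - 1) -
          fluxGap F v (fun _ => clip M c) i) / h)) =
      ∑ i ∈ I, cellWeight h ε i y * (χt * |c - v i| + χx * kruzkovFlux f c (v i)) +
      χ * ∑ i ∈ I, (-(nodeWeight h ε (i + 1) y - nodeWeight h ε i y) * kruzkovFlux f c (v i) +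
        cellWeight h ε i y * ((fluxGap F v (fun _ => clip M c) (i - 1) -
          fluxGap F v (fun _ => clip M c) i) / h)) := by
    rw [Finset.mul_sum, ← Finset.sum_add_distrib]
    exact Finset.sum_congr rfl fun i _ => by ring
  rw [hsplit]
  rw [← Finset.mul_sum] at h1
  -- Where the cutoff vanishes the weights need not sum to `1`, but then only the first sum survives
  -- and it is nonpositive.
  by_cases hχ0 : χ = 0
  · simpa [hχ0] using h1
  obtain ⟨ha, hb⟩ := hy hχ0
  have h2 := sum_flux_consistency_le hF hM hL hε hh hv c hab ha hb
  have h3 := sum_cellWeight_mul_abs_sub_le hε hh0 v hab ha hb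
  have hone := sum_cellWeight hε hab ha hb
  have h4 : |c - cellFunction h v y| - ∑ i ∈ I, cellWeight h ε i y * |cellFunction h v y - v i| ≤
      ∑ i ∈ I, cellWeight h ε i y * |c - v i| := by
    rw [sub_le_iff_le_add, ← Finset.sum_add_distrib]
    calc |c - cellFunction h v y| = ∑ i ∈ I, cellWeight h ε i y * |c - cellFunction h v y| := by
          rw [← Finset.sum_mul, hone, one_mul]
      _ ≤ _ := by
          refine Finset.sum_le_sum fun i _ => ?_
          rw [← mul_add]
          refine mul_le_mul_of_nonneg_left ?_ (cellWeight_nonneg hh0.le hε i y)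
          rw [abs_sub_comm (cellFunction h v y)]
          exact abs_sub_le _ _ _
  have h5 : ∑ i ∈ I, cellError p L v i * (weightSupport h ε i).indicator 1 y =
      ∑ i ∈ I, |v (i + 1) - v i| * (weightSupport h ε i).indicator 1 y +
      ∑ i ∈ I, 6 * L * stencilVariation p v i * (weightSupport h ε i).indicator 1 y := by
    rw [← Finset.sum_add_distrib]
    exact Finset.sum_congr rfl fun i _ => by unfold cellError; ring
  rw [h5]
  have h6 := mul_le_mul_of_nonneg_left (h4.trans' (sub_le_sub_left h3 _)) hχ
  have h7 := mul_le_mul_of_nonneg_left h2 hχ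
  linarith

lemma volume_restrict_spaceTime :
    volume.restrict spaceTime = (volume : Measure ℝ).prod (volume.restrict (Ici (0 : ℝ))) := by
  rw [spaceTime, Measure.volume_eq_prod, ← Measure.prod_restrict, Measure.restrict_univ]

/-- Integration of the local errors over space-time. -/
lemma integral_sum_cellError_le {h ε W : ℝ} (hh : 0 ≤ h) (hε : 0 ≤ ε) {E : ℤ → ℝ → ℝ}
    (hE : ∀ i, Continuous (E i)) (I : Finset ℤ) (hE0 : ∀ i t, 0 ≤ E i t)
    (hEW : ∀ t, ∑ i ∈ I, E i t ≤ W) :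
    Integrable (fun z : ℝ × ℝ => Real.exp (-z.2) *
      ∑ i ∈ I, E i z.2 * (weightSupport h ε i).indicator 1 z.1) (volume.restrict spaceTime) ∧
    ∫ z in spaceTime, Real.exp (-z.2) *
      ∑ i ∈ I, E i z.2 * (weightSupport h ε i).indicator 1 z.1 ≤ (2 * ε + h) * W := by
  have hexp : Integrable (fun t : ℝ => Real.exp (-t)) (volume.restrict (Ici 0)) := by
    have := integrableOn_exp_neg_Ioi 0
    rwa [← integrableOn_Ici_iff_integrableOn_Ioi] at this
  have hexp1 : ∫ t in Ici (0 : ℝ), Real.exp (-t) = 1 := by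
    rw [integral_Ici_eq_integral_Ioi, integral_exp_neg_Ioi_zero]
  have hW (i) (hi : i ∈ I) (t) : |E i t| ≤ W := by
    rw [abs_of_nonneg (hE0 i t)]
    exact (Finset.single_le_sum (fun j _ => hE0 j t) hi).trans (hEW t)
  have hEi (i) (hi : i ∈ I) :
      Integrable (fun t => Real.exp (-t) * E i t) (volume.restrict (Ici 0)) :=
    hexp.mul_bdd (c := W) (hE i).aestronglyMeasurable (Eventually.of_forall (hW i hi))
  have hprod (i) (hi : i ∈ I) : Integrable (fun z : ℝ × ℝ =>
      (weightSupport h ε i).indicator 1 z.1 * (Real.exp (-z.2) * E i z.2))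
      (volume.restrict spaceTime) := by
    rw [volume_restrict_spaceTime]
    exact (integrable_indicator_weightSupport h ε i).mul_prod (hEi i hi)
  have heq (z : ℝ × ℝ) : Real.exp (-z.2) *
      ∑ i ∈ I, E i z.2 * (weightSupport h ε i).indicator 1 z.1 =
      ∑ i ∈ I, (weightSupport h ε i).indicator 1 z.1 * (Real.exp (-z.2) * E i z.2) := by
    rw [Finset.mul_sum]
    exact Finset.sum_congr rfl fun i _ => by ring
  simp only [heq]
  refine ⟨integrable_finsetSum _ hprod, ?_⟩
  rw [integral_finsetSum _ hprod]
  -- Space and time separate: each support has length `2ε + h`, and the exponential has unit mass on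
  -- `[0, ∞)`.
  have hval (i : ℤ) : ∫ z in spaceTime, (weightSupport h ε i).indicator 1 z.1 *
      (Real.exp (-z.2) * E i z.2) = (2 * ε + h) * ∫ t in Ici (0 : ℝ), Real.exp (-t) * E i t := by
    rw [volume_restrict_spaceTime, ← integral_indicator_weightSupport hh hε i]
    exact integral_prod_mul ((weightSupport h ε i).indicator (1 : ℝ → ℝ))
      (fun t => Real.exp (-t) * E i t)
  simp only [hval]
  rw [← Finset.mul_sum, ← integral_finsetSum _ hEi]
  refine mul_le_mul_of_nonneg_left ?_ (by positivity)
  calc ∫ t in Ici (0 : ℝ), ∑ i ∈ I, Real.exp (-t) * E i t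
      ≤ ∫ t in Ici (0 : ℝ), Real.exp (-t) * W := by
        refine integral_mono (integrable_finsetSum _ hEi) (hexp.mul_const W) fun t => ?_
        simp only [← Finset.mul_sum]
        exact mul_le_mul_of_nonneg_left (hEW t) (Real.exp_pos _).le
    _ = W := by rw [integral_mul_const, hexp1, one_mul]

/-! ### Grid functions and the entropy production of the scheme -/

lemma measurable_gridFunction (h : ℝ) {X : ℤ → ℝ → ℝ} (hX : ∀ i, Measurable (X i)) :
    Measurable (gridFunction h X) := by
  have h1 : Measurable (Function.uncurry X) := measurable_from_prod_countable_right hX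
  have h2 : Measurable fun z : ℝ × ℝ => (⌊z.1 / h⌋, z.2) :=
    (Int.measurable_floor.comp (measurable_fst.div_const h)).prodMk measurable_snd
  exact h1.comp h2

lemma measurable_cellFunction (h : ℝ) (a : ℤ → ℝ) : Measurable (cellFunction h a) :=
  (measurable_of_countable a).comp (Int.measurable_floor.comp (measurable_id.div_const h))

/-- The growth rate of `|c - X i t|` along the scheme, for grid values `X`. -/
def entropyProduction (F : (Fin (2 * p) → ℝ) → ℝ) (M h : ℝ) (X : ℤ → ℝ → ℝ) (i : ℤ) (c t : ℝ) :
    ℝ :=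
  (fluxGap F (fun j => X j t) (fun _ => clip M c) (i - 1) -
    fluxGap F (fun j => X j t) (fun _ => clip M c) i) / h

lemma continuous_entropyProduction (hF : IsMonotoneFlux f M F) (h : ℝ) {X : ℤ → ℝ → ℝ}
    (hX : ∀ i, Continuous (X i)) (i : ℤ) :
    Continuous (Function.uncurry (entropyProduction F M h X i)) := by
  have hgap (m : ℤ) : Continuous fun z : ℝ × ℝ =>
      fluxGap F (fun j => X j z.2) (fun _ => clip M z.1) m := by
    unfold fluxGap interfaceFlux
    have := hF.continuous
    refine Continuous.sub (this.comp (continuous_pi fun k => ?_))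
      (this.comp (continuous_pi fun k => ?_))
    · exact ((hX _).comp continuous_snd).max ((continuous_clip M).comp continuous_fst)
    · exact ((hX _).comp continuous_snd).min ((continuous_clip M).comp continuous_fst)
  exact ((hgap (i - 1)).sub (hgap i)).div_const h

lemma abs_entropyProduction_le (hM : 0 ≤ M) (hL : IsFluxLipschitz F M L) {h : ℝ} (hh : 0 < h)
    {X : ℤ → ℝ → ℝ} (hX : ∀ i t, |X i t| ≤ M) (i : ℤ) (c t : ℝ) :
    |entropyProduction F M h X i c t| ≤ 4 * L * M / h := by
  have hgap (m : ℤ) : |fluxGap F (fun j => X j t) (fun _ => clip M c) m| ≤ L * (2 * M) :=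
    hL.abs_fluxGap_le (fun j => hX j t) (fun _ => abs_clip_le hM c) (by positivity) fun j _ _ =>
      (abs_sub _ _).trans (by linarith [hX j t, abs_clip_le hM c])
  rw [entropyProduction, abs_div, abs_of_pos hh]
  gcongr
  refine (abs_sub _ _).trans ?_
  linarith [hgap (i - 1), hgap i]

lemma abs_entropyProduction_sub_le (hM : 0 ≤ M) (hL : IsFluxLipschitz F M L) {h : ℝ} (hh : 0 < h)
    {X : ℤ → ℝ → ℝ} (hX : ∀ i t, |X i t| ≤ M) {Λ s t : ℝ}
    (hst : ∀ i, |X i t - X i s| ≤ Λ * |t - s|) (i : ℤ) (c : ℝ) :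
    |entropyProduction F M h X i c t - entropyProduction F M h X i c s| ≤
      4 * L * Λ / h * |t - s| := by
  have hgap (m : ℤ) := hL.abs_fluxGap_sub_le (m := m) (fun j => hX j t) (fun j => hX j s)
    (abs_clip_le hM c) ((abs_nonneg _).trans (hst 0)) fun j _ _ => hst j
  rw [entropyProduction, entropyProduction, ← sub_div, sub_sub_sub_comm, abs_div, abs_of_pos hh,
    div_mul_eq_mul_div]
  gcongr
  refine (abs_sub _ _).trans ?_
  linarith [hgap (i - 1), hgap i]

/-- The integrated entropy inequality of the scheme, for all constants. -/
lemma IsSchemeSolution.abs_const_sub_le {h : ℝ} {a : ℤ → ℝ} {U : ℤ → ℝ → ℝ}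
    (hU : IsSchemeSolution F h a U) (hF : IsMonotoneFlux f M F) (hh : 0 < h) (hM : 0 ≤ M)
    (ha : ∀ i, |a i| ≤ M) (i : ℤ) (c : ℝ) {s t : ℝ} (hs : 0 ≤ s) (hst : s ≤ t) :
    |c - U i t| - |c - U i s| ≤
      ∫ r in s..t, entropyProduction F M h (fun i t => U i (max t 0)) i c r := by
  have hUM i t (ht : 0 ≤ t) := hU.abs_le hF hh hM ha i ht
  -- The comparison constant is `clip M c`, so that both solutions take values in `[-M, M]`; the
  -- remainder `|c - clip M c|` is constant in time and cancels.
  have h1 := hU.abs_sub_le_add_integral (isSchemeSolution_const hF h (clip M c)) hF hh hUM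
    (fun _ _ _ => abs_clip_le hM c) i hs hst
  rw [abs_sub_eq_clip (hUM i t (hs.trans hst)), abs_sub_eq_clip (hUM i s hs),
    add_sub_add_right_eq_sub, sub_le_iff_le_add']
  refine h1.trans_eq ?_
  congr 1
  refine intervalIntegral.integral_congr fun r hr => ?_
  rw [uIcc_of_le hst] at hr
  simp only [entropyProduction, max_eq_left (hs.trans hr.1)]

/-! ### Deterministic `L¹` error estimates -/

/-- The error of the scheme, localized by a cutoff on a backward cone. -/
lemma IsSchemeSolution.integral_coneCutoff_mul_le {h ε : ℝ} {a : ℤ → ℝ} {U : ℤ → ℝ → ℝ}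
    (hU : IsSchemeSolution F h a U) (hf : ContDiff ℝ 1 f) (hF : IsMonotoneFlux f M F)
    (hL : IsFluxLipschitz F M L) (hM : 0 ≤ M) (hε : 0 < ε) (hh : ε ^ 2 = h)
    (ha : ∀ i, |a i| ≤ M) {V : ℝ} (hV : eVariationOn a univ ≤ ENNReal.ofReal V)
    {u₀ : ℝ → ℝ} {u : ℝ × ℝ → ℝ} (hu : IsEntropySolution f u₀ u) (hum : Measurable u)
    (hu₀m : Measurable u₀) (hu₀ : ∀ᵐ x, |u₀ x| ≤ M) {I₀ : ℝ}
    (hI : ∫⁻ x, ENNReal.ofReal |cellFunction h a x - u₀ x| ≤ ENNReal.ofReal I₀)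
    {B ℓ : ℝ} (hMB : M ≤ B) (huB : ∀ᵐ z ∂volume.restrict spaceTime, |u z| ≤ B) (hℓ : 0 < ℓ)
    (hfℓ : ∀ x y, |x| ≤ B → |y| ≤ B → |f x - f y| ≤ ℓ * |x - y|) (R : ℝ) :
    IntegrableOn (fun z => coneCutoff ℓ R z * |u z - gridFunction h U z|) spaceTime ∧
    ∫ z in spaceTime, coneCutoff ℓ R z * |u z - gridFunction h U z| ≤
      (2 * ε + h) * ((1 + 12 * L * p) * max V 0) + (max I₀ 0 + (2 * ε + h) * max V 0) := by
  have hh0 : 0 < h := hh ▸ by positivity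
  have hL0 := hL.1
  -- Extending by the initial value to negative times makes continuity and bounds hold on all of
  -- `ℝ`.
  set X : ℤ → ℝ → ℝ := fun i t => U i (max t 0) with hXdef
  have hXU (i) {t} (ht : 0 ≤ t) : X i t = U i t := by simp only [hXdef, max_eq_left ht]
  have hXc (i) : Continuous (X i) :=
    (hU.continuousOn i).comp_continuous (by fun_prop) fun t => le_max_right t 0
  have hXM (i t) : |X i t| ≤ M := hU.abs_le hF hh0 hM ha i (le_max_right _ _)
  have hXW (t) (s : Finset ℤ) : ∑ i ∈ s, |X (i + 1) t - X i t| ≤ max V 0 :=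
    hU.sum_abs_sub_succ_le hF hh0 hM ha hV (le_max_right t 0) s
  obtain ⟨Λ, hΛ, hUΛ⟩ := hU.exists_lipschitz hF hh0 hM ha
  have hXΛ (s t) (hs : 0 ≤ s) (ht : 0 ≤ t) (i) : |X i t - X i s| ≤ Λ * |t - s| := by
    rw [hXU i hs, hXU i ht]; exact hUΛ i s t hs ht
  set Λ' := Λ + 4 * L * Λ / h with hΛ'
  have hΛ1 : Λ ≤ Λ' := by rw [hΛ']; have : 0 ≤ 4 * L * Λ / h := by positivity
                          linarith
  have hΛ2 : 4 * L * Λ / h ≤ Λ' := by rw [hΛ']; linarith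
  set G := entropyProduction F M h X with hG
  set χ := coneCutoff ℓ R with hχ
  have hχT : IsTestFunction χ := isTestFunction_coneCutoff hℓ R
  have hχ0 (z) : 0 ≤ χ z := coneCutoff_nonneg ℓ R z
  set v := gridFunction h X with hv
  have hvm : Measurable v := measurable_gridFunction h fun i => (hXc i).measurable
  have hvM (z) : |v z| ≤ M := hXM _ _
  have hvU (z) (hz : z ∈ spaceTime) : gridFunction h U z = v z :=
    (hXU _ (show 0 ≤ z.2 from hz.2)).symm
  -- the cells that meet the cone
  obtain ⟨n, hn⟩ := exists_nat_ge ((R + 2 * ε) / h)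
  rw [div_le_iff₀ hh0] at hn
  set I := Finset.Ico (-n : ℤ) n
  have hnn : (-n : ℤ) ≤ n := by lia
  have hsupp (z : ℝ × ℝ) (hz : 0 ≤ z.2) (h0 : χ z ≠ 0) :
      ((-n : ℤ) : ℝ) * h ≤ z.1 ∧ z.1 + 2 * ε ≤ ((n : ℤ) : ℝ) * h := by
    have h1 := (abs_lt_of_coneCutoff_ne_zero h0).1
    have h2 := abs_lt.1 h1
    have h3 : 0 ≤ ℓ * z.2 := by positivity
    push_cast
    constructor <;> linarith
  -- Kruzhkov's inequality for each cell
  set φ : ℤ → ℝ × ℝ → ℝ := fun i z => χ z * cellWeight h ε i z.1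
  have hbc (i : ℤ) : ContDiff ℝ 1 fun z : ℝ × ℝ => cellWeight h ε i z.1 :=
    (contDiff_cellWeight h ε i).comp contDiff_fst
  have hφ (i : ℤ) : IsTestFunction (φ i) := hχT.mul_right (hbc i)
  have hdt (i : ℤ) (z) : dt (φ i) z = dt χ z * cellWeight h ε i z.1 := by
    rw [dt_mul hχT.1 (hbc i), dt_comp_fst (hasDerivAt_cellWeight h ε i z.1), mul_zero, add_zero]
  have hdx (i : ℤ) (z) : dx (φ i) z = dx χ z * cellWeight h ε i z.1 +
      χ z * -(nodeWeight h ε (i + 1) z.1 - nodeWeight h ε i z.1) := by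
    rw [dx_mul hχT.1 (hbc i), dx_comp_fst (hasDerivAt_cellWeight h ε i z.1)]
  -- In cell `i` the moving constant is `X i`, and the rate `G` is the right-hand side of the cell
  -- entropy inequality.
  have hkru (i : ℤ) := hu.kruzkov_time_dependent hf hum hu₀m hu₀ (hXc i) (hXM i)
    (hΛ.trans hΛ1) (fun s t hs ht => (hXΛ s t hs ht i).trans
      (mul_le_mul_of_nonneg_right hΛ1 (abs_nonneg _)))
    (continuous_entropyProduction hF h hXc i)
    (fun c t => abs_entropyProduction_le hM hL hh0 hXM i c t)
    (fun c s t hs ht => (abs_entropyProduction_sub_le hM hL hh0 hXM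
      (hXΛ s t hs ht) i c).trans (mul_le_mul_of_nonneg_right hΛ2 (abs_nonneg _)))
    (fun c s t hs hst => by
      rw [hXU i hs, hXU i (hs.trans hst)]
      exact hU.abs_const_sub_le hF hh0 hM ha i c hs hst)
    (hφ i) fun z _ => mul_nonneg (hχ0 z) (cellWeight_nonneg hh0.le hε i _)
  have htot := Finset.sum_nonneg fun i (_ : i ∈ I) => (hkru i).2.2
  rw [Finset.sum_add_distrib, ← integral_finsetSum _ fun i _ => (hkru i).1,
    ← integral_finsetSum _ fun i _ => (hkru i).2.1] at htot
  -- the bulk term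
  obtain ⟨herr, herr_le⟩ := integral_sum_cellError_le hh0.le hε.le (I := I)
    (E := fun i t => cellError p L (fun j => X j t) i) (W := (1 + 12 * L * p) * max V 0)
    (fun i => by unfold cellError stencilVariation; fun_prop)
    (fun i t => cellError_nonneg p hL0 _ i) (fun t => sum_cellError_le p hL0 (hXW t) I)
  have hmain_int : IntegrableOn (fun z => χ z * |u z - v z|) spaceTime := by
    refine (hχT.integrable _).mul_bdd (c := B + M)
      (Measurable.aestronglyMeasurable (by fun_prop)) ?_
    filter_upwards [huB] with z hz
    rw [Real.norm_eq_abs, abs_abs]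
    exact (abs_sub _ _).trans (add_le_add hz (hvM z))
  have hbulk : ∫ z in spaceTime, ∑ i ∈ I, (dt (φ i) z * |u z - X i z.2| +
      dx (φ i) z * kruzkovFlux f (u z) (X i z.2) + φ i z * G i (u z) z.2) ≤
      -(∫ z in spaceTime, χ z * |u z - v z|) +
        (2 * ε + h) * ((1 + 12 * L * p) * max V 0) := by
    refine le_trans ?_ (add_le_add_right herr_le _)
    have hneg : IntegrableOn (fun z => -(χ z * |u z - v z|)) spaceTime := hmain_int.neg
    rw [← integral_neg, ← integral_add hneg herr]
    refine integral_mono_ae (integrable_finsetSum _ fun i _ => (hkru i).1)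
      (hneg.add herr) ?_
    filter_upwards [huB, ae_restrict_mem measurableSet_spaceTime] with z hz hzs
    have hs : 0 ≤ z.2 := hzs.2
    simp only [hdt, hdx]
    refine (sum_pairing_le hF hM hL hε hh (v := fun j => X j z.2) (fun j => hXM j _)
      (fun i => abs_kruzkovFlux_le hfℓ hz ((hXM i _).trans hMB)) hnn (hχ0 z)
      (dt_coneCutoff_add_le hℓ.le R hs) (hsupp z hs)).trans ?_
    refine add_le_add_right ?_ _
    refine mul_le_mul_of_nonneg_right (coneCutoff_le ℓ R z) ?_
    exact Finset.sum_nonneg fun i _ => mul_nonneg (cellError_nonneg p hL0 _ i)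
      (indicator_nonneg (fun _ _ => zero_le_one) _)
  -- the initial term
  have hX0 (i) : X i 0 = a i := by rw [hXU i le_rfl, hU.initial]
  have hcell_m : Measurable fun x => |cellFunction h a x - u₀ x| :=
    ((measurable_cellFunction h a).sub hu₀m).abs
  have hcell : Integrable fun x => |cellFunction h a x - u₀ x| := by
    refine ⟨hcell_m.aestronglyMeasurable, ?_⟩
    rw [hasFiniteIntegral_iff_ofReal (Eventually.of_forall fun x => abs_nonneg _)]
    exact hI.trans_lt ENNReal.ofReal_lt_top
  have hcell_le : ∫ x, |cellFunction h a x - u₀ x| ≤ max I₀ 0 := by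
    rw [integral_eq_lintegral_of_nonneg_ae (Eventually.of_forall fun x => abs_nonneg _)
      hcell_m.aestronglyMeasurable, ← ENNReal.toReal_ofReal']
    exact ENNReal.toReal_mono ENNReal.ofReal_ne_top hI
  have hjump_int (i : ℤ) (_ : i ∈ I) : Integrable fun x =>
      |a (i + 1) - a i| * (weightSupport h ε i).indicator 1 x :=
    (integrable_indicator_weightSupport h ε i).const_mul _
  have hinit : ∫ x, ∑ i ∈ I, φ i (x, 0) * |u₀ x - X i 0| ≤
      max I₀ 0 + (2 * ε + h) * max V 0 := by
    calc ∫ x, ∑ i ∈ I, φ i (x, 0) * |u₀ x - X i 0|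
        ≤ ∫ x, (|cellFunction h a x - u₀ x| +
            ∑ i ∈ I, |a (i + 1) - a i| * (weightSupport h ε i).indicator 1 x) := by
          refine integral_mono (integrable_finsetSum _ fun i _ => (hkru i).2.1)
            (hcell.add (integrable_finsetSum _ hjump_int)) fun x => ?_
          have hnn' : 0 ≤ |cellFunction h a x - u₀ x| +
              ∑ i ∈ I, |a (i + 1) - a i| * (weightSupport h ε i).indicator 1 x :=
            add_nonneg (abs_nonneg _) (Finset.sum_nonneg fun i _ => mul_nonneg (abs_nonneg _)
              (indicator_nonneg (fun _ _ => zero_le_one) _))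
          by_cases h0 : χ (x, 0) = 0
          · simpa [φ, h0] using hnn'
          obtain ⟨hxa, hxb⟩ := hsupp (x, 0) le_rfl h0
          have h1 := sum_cellWeight_mul_abs_sub_le hε hh0 a hnn hxa hxb
          have h2 := sum_cellWeight hε hnn hxa hxb
          have h3 : χ (x, 0) ≤ 1 := by simpa using coneCutoff_le ℓ R (x, 0)
          calc ∑ i ∈ I, φ i (x, 0) * |u₀ x - X i 0|
              ≤ ∑ i ∈ I, (cellWeight h ε i x * |cellFunction h a x - u₀ x| +
                  cellWeight h ε i x * |cellFunction h a x - a i|) := by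
                refine Finset.sum_le_sum fun i _ => ?_
                have hb := cellWeight_nonneg hh0.le hε i x
                rw [hX0, ← mul_add]
                refine mul_le_mul (mul_le_of_le_one_left hb h3) ?_ (abs_nonneg _) hb
                rw [abs_sub_comm (cellFunction h a x)]
                exact abs_sub_le _ _ _
            _ ≤ _ := by
                rw [Finset.sum_add_distrib, ← Finset.sum_mul, h2, one_mul]
                exact add_le_add_right h1 _
      _ = (∫ x, |cellFunction h a x - u₀ x|) + (2 * ε + h) * ∑ i ∈ I, |a (i + 1) - a i| := by
          rw [integral_add hcell (integrable_finsetSum _ hjump_int),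
            integral_finsetSum _ hjump_int, Finset.mul_sum]
          congr 1
          refine Finset.sum_congr rfl fun i _ => ?_
          rw [integral_const_mul, integral_indicator_weightSupport hh0.le hε.le, mul_comm]
      _ ≤ _ := by
          have := hXW 0 I
          simp only [hX0] at this
          gcongr
  have hcongr : ∀ z ∈ spaceTime, χ z * |u z - v z| = χ z * |u z - gridFunction h U z| :=
    fun z hz => by rw [hvU z hz]
  refine ⟨hmain_int.congr_fun hcongr measurableSet_spaceTime, ?_⟩
  rw [← setIntegral_congr_fun measurableSet_spaceTime hcongr]
  linarith

/-- The `L¹` error estimate on a strip, for a single initial datum. -/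
lemma IsSchemeSolution.lintegral_abs_sub_le {h ε : ℝ} {a : ℤ → ℝ} {U : ℤ → ℝ → ℝ}
    (hU : IsSchemeSolution F h a U) (hf : ContDiff ℝ 1 f) (hF : IsMonotoneFlux f M F)
    (hL : IsFluxLipschitz F M L) (hM : 0 ≤ M) (hε : 0 < ε) (hh : ε ^ 2 = h)
    (ha : ∀ i, |a i| ≤ M) {V : ℝ} (hV : eVariationOn a univ ≤ ENNReal.ofReal V)
    {u₀ : ℝ → ℝ} {u : ℝ × ℝ → ℝ} (hu : IsEntropySolution f u₀ u) (hum : Measurable u)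
    (hu₀m : Measurable u₀) (hu₀ : ∀ᵐ x, |u₀ x| ≤ M) {I₀ : ℝ}
    (hI : ∫⁻ x, ENNReal.ofReal |cellFunction h a x - u₀ x| ≤ ENNReal.ofReal I₀) (T : ℝ) :
    ∫⁻ z in spaceTimeStrip T, ENNReal.ofReal |u z - gridFunction h U z| ≤
      ENNReal.ofReal (Real.exp T * ((2 * ε + h) * ((1 + 12 * L * p) * max V 0) +
        (max I₀ 0 + (2 * ε + h) * max V 0))) := by
  obtain ⟨B, hMB, huB⟩ := hu.exists_bound M
  obtain ⟨ℓ, hℓ0, hℓ⟩ := hf.exists_lipschitz_Icc B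
  -- Adding `1` ensures a positive speed, which the compact support of the cutoff needs. The
  -- resulting bound depends on neither the speed nor `R`, so the strip can be exhausted.
  have hest := hU.integral_coneCutoff_mul_le hf hF hL hM hε hh ha hV hu hum hu₀m hu₀ hI hMB huB
    (show 0 < ℓ + 1 by positivity) fun x y hx hy => (hℓ x y hx hy).trans
      (mul_le_mul_of_nonneg_right (by linarith) (abs_nonneg _))
  set E := (2 * ε + h) * ((1 + 12 * L * p) * max V 0) + (max I₀ 0 + (2 * ε + h) * max V 0)
  set S : ℕ → Set (ℝ × ℝ) := fun n => Icc (-n : ℝ) n ×ˢ Icc 0 T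
  have hS : spaceTimeStrip T = ⋃ n, S n := by
    ext z
    simp only [S, spaceTimeStrip, mem_iUnion, mem_prod, mem_univ, true_and, mem_Icc]
    refine ⟨fun hz => ?_, fun ⟨n, hn⟩ => hn.2⟩
    obtain ⟨n, hn⟩ := exists_nat_ge |z.1|
    exact ⟨n, _root_.abs_le.1 hn, hz⟩
  rw [hS, setLIntegral_iUnion_of_directed]
  swap
  · refine (monotone_nat_of_le_succ fun n => ?_).directed_le
    refine prod_mono_left (Icc_subset_Icc ?_ ?_) <;> push_cast <;> linarith
  refine iSup_le fun n => ?_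
  -- The cone over this base contains `S n` with the margin `2` of the step, so the cutoff is
  -- exactly `e^{-t}` on `S n`.
  set R := n + (ℓ + 1) * T + 2
  have hSm : MeasurableSet (S n) := measurableSet_Icc.prod measurableSet_Icc
  have hSsub : S n ⊆ spaceTime := fun z hz => ⟨mem_univ _, hz.2.1⟩
  have hχ (z) (hz : z ∈ S n) : 1 ≤ Real.exp T * coneCutoff (ℓ + 1) R z := by
    have h1 : |z.1| ≤ n := _root_.abs_le.2 hz.1
    have h2 : (ℓ + 1) * z.2 ≤ (ℓ + 1) * T := mul_le_mul_of_nonneg_left hz.2.2 (by positivity)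
    rw [coneCutoff_eq hz.2.1 (by linarith), ← Real.exp_add]
    exact Real.one_le_exp (by linarith [hz.2.2])
  obtain ⟨hint, hle⟩ := hest R
  calc ∫⁻ z in S n, ENNReal.ofReal |u z - gridFunction h U z|
      ≤ ∫⁻ z in S n, ENNReal.ofReal (Real.exp T *
          (coneCutoff (ℓ + 1) R z * |u z - gridFunction h U z|)) := by
        refine setLIntegral_mono' hSm fun z hz => ENNReal.ofReal_le_ofReal ?_
        rw [← mul_assoc]
        exact le_mul_of_one_le_left (abs_nonneg _) (hχ z hz)
    _ ≤ ∫⁻ z in spaceTime, ENNReal.ofReal (Real.exp T *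
          (coneCutoff (ℓ + 1) R z * |u z - gridFunction h U z|)) := lintegral_mono_set hSsub
    _ = ENNReal.ofReal (∫ z in spaceTime, Real.exp T *
          (coneCutoff (ℓ + 1) R z * |u z - gridFunction h U z|)) := by
        refine (ofReal_integral_eq_lintegral_ofReal (hint.const_mul _)
          (Eventually.of_forall fun z => ?_)).symm
        exact mul_nonneg (Real.exp_pos _).le (mul_nonneg (coneCutoff_nonneg _ _ _) (abs_nonneg _))
    _ ≤ _ := by
        rw [integral_const_mul]
        exact ENNReal.ofReal_le_ofReal (mul_le_mul_of_nonneg_left hle (Real.exp_pos _).le)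

end Comparison

/-! ### Laws of random fields -/

/-- The joint law of the two fields at the point is an admissible coupling. -/
lemma wasserstein_one_lawOf_le {Ω : Type*} [MeasurableSpace Ω] (P : Measure Ω)
    [IsProbabilityMeasure P] {v w : Ω → ℝ × ℝ → ℝ} {z : ℝ × ℝ} (hv : Measurable fun ω => v ω z)
    (hw : Measurable fun ω => w ω z) :
    wasserstein 1 (lawOf P v z) (lawOf P w z) ≤ ∫⁻ ω, ENNReal.ofReal |v ω z - w ω z| ∂P := by
  have hvw := hv.prodMk hw
  rw [wasserstein, div_one, ENNReal.rpow_one]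
  refine (iInf₂_le (P.map fun ω => (v ω z, w ω z))
    ⟨Measure.isProbabilityMeasure_map hvw.aemeasurable, ?_, ?_⟩).trans_eq ?_
  · simp only [ENNReal.rpow_one]
    rw [lintegral_map (by fun_prop) hvw]
  · rw [Measure.map_map measurable_fst hvw]; rfl
  · rw [Measure.map_map measurable_snd hvw]; rfl

/-- Measurability of a random field of grid functions. -/
lemma measurable_uncurry_gridFunction {Ω : Type*} [MeasurableSpace Ω] (h : ℝ)
    {X : Ω → ℤ → ℝ → ℝ} (hXm : ∀ i t, Measurable fun ω => X ω i t)
    (hXc : ∀ ω i, Continuous (X ω i)) :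
    Measurable (Function.uncurry fun ω => gridFunction h (X ω)) := by
  have h1 : Measurable fun q : ℤ × (ℝ × Ω) => X q.2.2 q.1 q.2.1 :=
    measurable_from_prod_countable_right fun i =>
      measurable_uncurry_of_continuous_of_measurable (u := fun t ω => X ω i t)
        (fun ω => hXc ω i) (hXm i)
  have h2 : Measurable fun q : Ω × (ℝ × ℝ) => (⌊q.2.1 / h⌋, (q.2.2, q.1)) :=
    (Int.measurable_floor.comp (measurable_snd.fst.div_const h)).prodMk
      (measurable_snd.snd.prodMk measurable_fst)
  exact h1.comp h2

/-! ### The random error estimate and strong convergence -/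

theorem mainTheorem9 (f : ℝ → ℝ) (hf : ContDiff ℝ 1 f)
    (T M V K : ℝ)
    (p : ℕ) (F : (Fin (2 * p) → ℝ) → ℝ) (hF : IsMonotoneFlux f M F) :
    ∃ C : ℝ, ∀ (Ω : Type*) [MeasurableSpace Ω] (P : Measure Ω) [IsProbabilityMeasure P]
      -- the initial random field
      (u₀ : Ω → ℝ → ℝ) (_ : Measurable (Function.uncurry u₀))
      (_ : ∀ ω, ∀ᵐ x, |u₀ ω x| ≤ M)
      (_ : ∀ ω, totalVariation (u₀ ω) ≤ ENNReal.ofReal V)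
      -- its approximation by grid functions
      (a : ℝ → Ω → ℤ → ℝ)
      (_ : ∀ h ∈ Ioc (0 : ℝ) 1, ∀ ω i, |a h ω i| ≤ M)
      (_ : ∀ h ∈ Ioc (0 : ℝ) 1, ∀ ω, eVariationOn (a h ω) univ ≤ ENNReal.ofReal V)
      (_ : ∀ h ∈ Ioc (0 : ℝ) 1, ∀ ω,
        ∫⁻ x, ENNReal.ofReal |cellFunction h (a h ω) x - u₀ ω x| ≤ ENNReal.ofReal (K * √h))
      -- the random field computed by the scheme
      (U : ℝ → Ω → ℤ → ℝ → ℝ)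
      (_ : ∀ h ∈ Ioc (0 : ℝ) 1, ∀ ω, IsSchemeSolution F h (a h ω) (U h ω))
      (_ : ∀ h ∈ Ioc (0 : ℝ) 1, ∀ i, ∀ t : ℝ, 0 ≤ t → Measurable fun ω => U h ω i t)
      -- the random field of entropy solutions
      (u : Ω → ℝ × ℝ → ℝ) (_ : Measurable (Function.uncurry u))
      (_ : ∀ ω, IsEntropySolution f (u₀ ω) (u ω)),
      (∀ h ∈ Ioc (0 : ℝ) 1,
        ∫⁻ z in spaceTimeStrip T,
          wasserstein 1 (lawOf P (fun ω => gridFunction h (U h ω)) z) (lawOf P u z) ≤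
            ENNReal.ofReal (C * √h)) ∧
      ConvergesStrongly (spaceTimeStrip T) (𝓝[>] (0 : ℝ))
        (fun h => lawOf P fun ω => gridFunction h (U h ω)) (lawOf P u) := by
  -- For `M < 0` there are no admissible grid values, while a probability space has at least one
  -- sample.
  rcases lt_or_ge M 0 with hM | hM
  · refine ⟨0, fun Ω _ P _ u₀ _ _ _ a ha => ?_⟩
    obtain ⟨ω⟩ := nonempty_of_isProbabilityMeasure P
    exact absurd ((abs_nonneg _).trans (ha 1 ⟨one_pos, le_rfl⟩ ω 0)) (not_le.2 hM)
  obtain ⟨L, hL⟩ := hF.exists_isFluxLipschitz hM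
  have hL0 := hL.1
  -- The factors `3` come from `2ε + h ≤ 3√h`, valid for `ε = √h` and `h ≤ 1`.
  set C := Real.exp T * (3 * ((1 + 12 * L * p) * max V 0) + (max K 0 + 3 * max V 0)) with hC
  refine ⟨C, fun Ω _ P _ u₀ hu₀m hu₀ _ a ha hV hI U hU hUm u hum hu => ?_⟩
  have key : ∀ h ∈ Ioc (0 : ℝ) 1, ∫⁻ z in spaceTimeStrip T,
      wasserstein 1 (lawOf P (fun ω => gridFunction h (U h ω)) z) (lawOf P u z) ≤
        ENNReal.ofReal (C * √h) := by
    intro h hh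
    have hε : 0 < √h := Real.sqrt_pos.2 hh.1
    have hε2 : √h ^ 2 = h := Real.sq_sqrt hh.1.le
    have hhε : h ≤ √h := by
      have : √h ≤ 1 := Real.sqrt_le_one.2 hh.2
      nlinarith
    have hstrip : MeasurableSet (spaceTimeStrip T) := MeasurableSet.univ.prod measurableSet_Icc
    -- Joint measurability, needed for Tonelli, follows from continuity in time and measurability in
    -- the sample once the values are extended to negative times.
    set X : Ω → ℤ → ℝ → ℝ := fun ω i t => U h ω i (max t 0)
    have hXm := measurable_uncurry_gridFunction h (X := X)
      (fun i t => hUm h hh i _ (le_max_right t 0)) fun ω i =>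
        ((hU h hh ω).continuousOn i).comp_continuous (by fun_prop) fun t => le_max_right t 0
    have hXU (ω) (z) (hz : z ∈ spaceTimeStrip T) :
        gridFunction h (X ω) z = gridFunction h (U h ω) z :=
      congrArg (U h ω _) (max_eq_left hz.2.1)
    have hdet (ω : Ω) : ∫⁻ z in spaceTimeStrip T,
        ENNReal.ofReal |gridFunction h (X ω) z - u ω z| ≤ ENNReal.ofReal (C * √h) := by
      rw [setLIntegral_congr_fun hstrip (g := fun z =>
        ENNReal.ofReal |u ω z - gridFunction h (U h ω) z|)
        fun z hz => by simp only [hXU ω z hz, abs_sub_comm (u ω z)]]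
      refine ((hU h hh ω).lintegral_abs_sub_le hf hF hL hM hε hε2 (ha h hh ω) (hV h hh ω) (hu ω)
        (hum.comp measurable_prodMk_left) (hu₀m.comp measurable_prodMk_left) (hu₀ ω)
        (hI h hh ω) T).trans (ENNReal.ofReal_le_ofReal ?_)
      have h1 : max (K * √h) 0 = max K 0 * √h := by
        rw [max_mul_of_nonneg _ _ hε.le, zero_mul]
      have h2 : 2 * √h + h ≤ 3 * √h := by linarith
      calc _ ≤ Real.exp T * ((3 * √h) * ((1 + 12 * L * p) * max V 0) +
            (max (K * √h) 0 + (3 * √h) * max V 0)) := by gcongr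
        _ = C * √h := by rw [h1, hC]; ring
    calc ∫⁻ z in spaceTimeStrip T,
          wasserstein 1 (lawOf P (fun ω => gridFunction h (U h ω)) z) (lawOf P u z)
        ≤ ∫⁻ z in spaceTimeStrip T,
            ∫⁻ ω, ENNReal.ofReal |gridFunction h (X ω) z - u ω z| ∂P := by
          refine setLIntegral_mono' hstrip fun z hz => ?_
          simp only [hXU _ z hz]
          exact wasserstein_one_lawOf_le P (hUm h hh _ _ hz.2.1) (hum.comp measurable_prodMk_right)
      _ = ∫⁻ ω, (∫⁻ z in spaceTimeStrip T,
            ENNReal.ofReal |gridFunction h (X ω) z - u ω z|) ∂P := by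
          refine lintegral_lintegral_swap (Measurable.aemeasurable ?_)
          exact ((hXm.sub hum).comp measurable_swap).abs.ennreal_ofReal
      _ ≤ ∫⁻ _, ENNReal.ofReal (C * √h) ∂P := lintegral_mono hdet
      _ = ENNReal.ofReal (C * √h) := by simp
  refine ⟨key, 1, le_rfl, ?_⟩
  simp only [ENNReal.rpow_one, div_one]
  have hlim : Tendsto (fun h : ℝ => ENNReal.ofReal (C * √h)) (𝓝[>] 0) (𝓝 0) := by
    have : Continuous fun h : ℝ => ENNReal.ofReal (C * √h) :=
      ENNReal.continuous_ofReal.comp (by fun_prop)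
    simpa using (this.tendsto 0).mono_left nhdsWithin_le_nhds
  refine tendsto_of_tendsto_of_tendsto_of_le_of_le' tendsto_const_nhds hlim
    (Eventually.of_forall fun _ => zero_le) ?_
  filter_upwards [Ioc_mem_nhdsGT one_pos] with h hh using key h hh

end
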